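/- **Setting.** A Markov automaton (MA) $\mathcal M$ has a finite state set $S$ with an initial state $s_0$, a finite action set $Act$ with a distinguished action $\bot\in Act$, and transitions $s\xrightarrow{\kappa}\mu$ with $\kappa\in Act\,\dot\cup\,\mathbb R_{>0}$ and $\mu\in Dist(S)$. Every state is either probabilistic ($s\in PS$: it has at least one transition labelled by an action, at most one per action, and none labelled by a rate) or Markovian ($s\in MS$: it has exactly one transition, labelled by a rate, its exit rate $E(s)>0$); $S=PS\,\dot\cup\,MS$. Let $P(s,\alpha,s')=\mu(s')$ if $s\xrightarrow{\alpha}\mu$, or if $\alpha=\bot$ and $s\xrightarrow{E(s)}\mu$, and $P(s,\alpha,s')=0$ otherwise. An infinite path $\pi=s_0\xrightarrow{\kappa_0}s_1\xrightarrow{\kappa_1}\cdots$ has stamps $\kappa_i\in Act$ if $s_i\in PS$ (sojourn time $t_i=0$, action $\alpha_i=\kappa_i$) and $\kappa_i\in\mathbb R_{\ge0}$ if $s_i\in MS$ (sojourn time $t_i=\kappa_i$, action $\alpha_i=\bot$), with $P(s_i,\alpha_i,s_{i+1})>0$ for all $i$ and $\sum_i t_i=\infty$; put $T_n=\sum_{i<n}t_i$.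 A scheduler $\sigma$ measurably maps each finite timed path to a distribution over the actions enabled in its last state. It induces the probability measure $\Pr^{\sigma}$ on paths: in a probabilistic state, $\alpha$ is drawn from $\sigma$ and the successor $s'$ from $P(s,\alpha,\cdot)$; in a Markovian state, the sojourn time is exponential with rate $E(s)$ and, independently, $s'$ is drawn from $P(s,\bot,\cdot)$. The MA is assumed to be non-Zeno, i.e. under every scheduler $\sum_i t_i=\infty$ almost surely. Fix $\delta>0$ and let $\lambda=\max_{s\in MS}E(s)$. The digitization $\mathcal M_\delta$ is the MDP with initial state $s_0$ and the probabilities $P$, except that for $s\in MS$ $$P_\delta(s,\bot,s')=P(s,\bot,s')\,(1-e^{-E(s)\delta})+\mathbf 1_{s=s'}\,e^{-E(s)\delta}.$$ Its infinite paths are the sequences $\bar s_0\xrightarrow{\bar\alpha_0}\bar s_1\xrightarrow{\bar\alpha_1}\cdots$ with $\bar s_0=s_0$ and $P_\delta(\bar s_i,\bar\alpha_i,\bar s_{i+1})>0$ for all $i$. The digitization $\mathrm{di}(\pi)$ of a path $\pi$ replaces each step $s_i\xrightarrow{\kappa_i}s_{i+1}$ by $m_i=\max\{m\in\mathbb N\mid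 m\delta\le t_i\}$ self-loops $s_i\xrightarrow{\alpha_i}s_i$ followed by $s_i\xrightarrow{\alpha_i}s_{i+1}$; finite paths are digitized in the same way. The number $|\bar\pi|_{ds}$ of digitization steps of a finite digital path $\bar\pi$ is the number of its transitions that emerge from Markovian states. For $t\ge0$, let $\mathrm{pref}(\pi,t)$ be the longest prefix of $\pi$ of duration at most $t$. Let $I=[a,b]$ with $0\le a<b$, or $I=[a,\infty)$ with $0\le a$, where the finite end points are natural multiples of $\delta$. Put $$\mathrm{di}(I)=\{n\in\mathbb N\mid n\delta\in I\}\setminus\{a/\delta\mid a>0\},$$ so for $a=j\delta>0$ and $b=k\delta$ we have $\mathrm{di}([a,b])=\{j+1,\dots,k\}$, $\mathrm{di}([a,\infty))=\{j+1,j+2,\dots\}$, $\mathrm{di}([0,b])=\{0,\dots,k\}$ and $\mathrm{di}([0,\infty))=\mathbb N$. For $G\subseteq S$, let $\Diamond^{I}G$ be the set of infinite paths $\pi$ of $\mathcal M$ such that for some $n$, $s_n\in G$ and $I\cap[T_n,T_n+t_n]\neq\emptyset$. Let $\Diamond_{ds}^{J}G$ be the set of infinite paths of $\mathcal M_\delta$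 that have a prefix $\bar\pi$ ending in $G$ with $|\bar\pi|_{ds}\in J$. The error bounds are $$\varepsilon_l(I)=\begin{cases}0&a=0\\1-(1+\lambda\delta)^{a/\delta}e^{-\lambda a}&a>0,\end{cases}\qquad \varepsilon_u([a,b])=1-(1+\lambda\delta)^{b/\delta}e^{-\lambda b}+\varepsilon_u([a,\infty)),\qquad \varepsilon_u([a,\infty))=\begin{cases}0&a=0\\1-e^{-\lambda\delta}&a>0.\end{cases}$$ **Proposition.** Let $\sigma$ be any scheduler of a non-Zeno MA $\mathcal M$, and let $\delta>0$. 1. For every $k\in\mathbb N$, the probability of more than $k$ digitization steps within $k\delta$ time satisfies $$\Pr\nolimits^{\sigma}\big(\{\pi\mid|\mathrm{di}(\mathrm{pref}(\pi,k\delta))|_{ds}>k\}\big)\le1-(1+\lambda\delta)^{k}e^{-\lambda k\delta}.$$ 2. For every $G\subseteq S$ and every time interval $I$ as above, $$\Pr\nolimits^{\sigma}(\Diamond^{I}G)\in\Pr\nolimits^{\sigma}\big(\{\pi\mid\mathrm{di}(\pi)\in\Diamond_{ds}^{\mathrm{di}(I)}G\}\big)+\big[-\varepsilon_l(I),\ \varepsilon_u(I)\big].$$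 -/

import Mathlib

open MeasureTheory ProbabilityTheory Filter

noncomputable section

/-! ## Markov automata -/

/-- A Markov automaton (rewards, which play no role for reachability, are omitted) with state set
`S` and action set `Act`.  A transition is labelled by an action or by a positive rate, so labels
from `Act` and rates are disjoint.  `tau` is the distinguished Markovian action (often written as
bottom).  The automaton is action-deterministic, has no terminal states, and, by maximal progress,
no state has both a probabilistic and a Markovian transition. -/
structure MarkovAutomaton (S Act : Type*) where
  init : S
  tau : Act
  trans : Set (S × (Act ⊕ {r : ℝ // 0 < r}) × PMF S)
  markovian_unique : ∀ s r r' μ μ',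
    (s, Sum.inr r, μ) ∈ trans → (s, Sum.inr r', μ') ∈ trans → r = r' ∧ μ = μ'
  action_deterministic : ∀ s a μ μ',
    (s, Sum.inl a, μ) ∈ trans → (s, Sum.inl a, μ') ∈ trans → μ = μ'
  prob_or_markovian : ∀ s,
    (∃ a μ, (s, Sum.inl a, μ) ∈ trans) ∨ (∃ r μ, (s, Sum.inr r, μ) ∈ trans)
  not_prob_and_markovian : ∀ s,
    ¬ ((∃ a μ, (s, Sum.inl a, μ) ∈ trans) ∧ (∃ r μ, (s, Sum.inr r, μ) ∈ trans))

/-- A Markov decision process. -/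
structure MDP (S Act : Type*) [Fintype S] where
  init : S
  prob : S → Act → S → ℝ
  prob_mem : ∀ s a s', prob s a s' ∈ Set.Icc (0 : ℝ) 1
  sum_prob : ∀ s a, ∑ s', prob s a s' = 0 ∨ ∑ s', prob s a s' = 1

/-- A path starting in a fixed state `s₀` is given by its sequence of steps
`(label i, state (i + 1))`; this is the sequence of visited states. -/
def pathState {S L : Type*} (s₀ : S) (ω : ℕ → L × S) : ℕ → S
  | 0 => s₀
  | n + 1 => (ω n).2

/-- Infinite paths of an MDP: each transition has positive probability. -/
def MDP.infPaths {S Act : Type*} [Fintype S] (D : MDP S Act) : Set (ℕ → Act × S) :=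
  {ω | ∀ i, 0 < D.prob (pathState D.init ω i) (ω i).1 (pathState D.init ω (i + 1))}

/-- A stamp is an action or a sojourn time. -/
abbrev Stamp (Act : Type*) := Act ⊕ NNReal

/-- A step of a path of a Markov automaton: a stamp and the successor state. -/
abbrev Step (S Act : Type*) := Stamp Act × S

/-- The time of a stamp; it is zero for an action. -/
def Stamp.time {Act : Type*} : Stamp Act → ℝ
  | Sum.inl _ => 0
  | Sum.inr t => (t : ℝ)

/-- The action of a stamp; it is the Markovian action `tau` for a sojourn time. -/
def Stamp.action {Act : Type*} (tau : Act) : Stamp Act → Act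
  | Sum.inl a => a
  | Sum.inr _ => tau

namespace MarkovAutomaton

variable {S Act : Type*}

/-- Probabilistic states. -/
def PS (M : MarkovAutomaton S Act) : Set S := {s | ∃ a μ, (s, Sum.inl a, μ) ∈ M.trans}

/-- Markovian states. -/
def MS (M : MarkovAutomaton S Act) : Set S := {s | ∃ r μ, (s, Sum.inr r, μ) ∈ M.trans}

open Classical in
/-- The exit rate of a Markovian state (and `0` for other states). -/
def exitRate (M : MarkovAutomaton S Act) (s : S) : ℝ :=
  if h : ∃ r μ, (s, Sum.inr r, μ) ∈ M.trans then (h.choose : ℝ) else 0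

/-- The maximal exit rate. -/
def maxRate (M : MarkovAutomaton S Act) : ℝ := sSup (M.exitRate '' M.MS)

/-- From `s`, action `a` leads to the distribution `μ`: either by a probabilistic transition
labelled `a`, or `a = tau` and `μ` belongs to the Markovian transition of `s`. -/
def HasDist (M : MarkovAutomaton S Act) (s : S) (a : Act) (μ : PMF S) : Prop :=
  (s, Sum.inl a, μ) ∈ M.trans ∨ (a = M.tau ∧ ∃ r, (s, Sum.inr r, μ) ∈ M.trans)

open Classical in
/-- The transition probabilities of the automaton. -/
def prob (M : MarkovAutomaton S Act) (s : S) (a : Act) (s' : S) : ℝ :=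
  if h : ∃ μ, M.HasDist s a μ then (h.choose s').toReal else 0

/-- The enabled actions of a state. -/
def enabled (M : MarkovAutomaton S Act) (s : S) : Set Act := {a | ∃ s', 0 < M.prob s a s'}

theorem exitRate_pos (M : MarkovAutomaton S Act) {s : S} (hs : s ∈ M.MS) : 0 < M.exitRate s := by
  have h : ∃ r μ, (s, Sum.inr r, μ) ∈ M.trans := hs
  rw [exitRate, dif_pos h]
  exact h.choose.2

theorem exitRate_eq (M : MarkovAutomaton S Act) {s : S} {r : {r : ℝ // 0 < r}} {μ : PMF S}
    (hs : (s, Sum.inr r, μ) ∈ M.trans) : M.exitRate s = r := by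
  have h : ∃ r μ, (s, Sum.inr r, μ) ∈ M.trans := ⟨r, μ, hs⟩
  rw [exitRate, dif_pos h]
  exact congrArg _ (M.markovian_unique _ _ _ _ _ h.choose_spec.choose_spec hs).1

theorem HasDist.unique {M : MarkovAutomaton S Act} {s : S} {a : Act} {μ μ' : PMF S}
    (h : M.HasDist s a μ) (h' : M.HasDist s a μ') : μ = μ' := by
  rcases h with h | ⟨_, r, h⟩ <;> rcases h' with h' | ⟨_, r', h'⟩
  · exact M.action_deterministic _ _ _ _ h h'
  · exact absurd ⟨⟨_, _, h⟩, ⟨_, _, h'⟩⟩ (M.not_prob_and_markovian s)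
  · exact absurd ⟨⟨_, _, h'⟩, ⟨_, _, h⟩⟩ (M.not_prob_and_markovian s)
  · exact (M.markovian_unique _ _ _ _ _ h h').2

theorem prob_eq {M : MarkovAutomaton S Act} {s : S} {a : Act} {μ : PMF S}
    (h : M.HasDist s a μ) (s' : S) : M.prob s a s' = (μ s').toReal := by
  have h' : ∃ μ, M.HasDist s a μ := ⟨μ, h⟩
  rw [prob, dif_pos h', h'.choose_spec.unique h]

theorem prob_mem (M : MarkovAutomaton S Act) (s : S) (a : Act) (s' : S) :
    M.prob s a s' ∈ Set.Icc (0 : ℝ) 1 := by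
  by_cases h : ∃ μ, M.HasDist s a μ
  · obtain ⟨μ, h⟩ := h
    rw [prob_eq h]
    exact ⟨ENNReal.toReal_nonneg, ENNReal.toReal_le_of_le_ofReal zero_le_one
      (by simpa using μ.coe_le_one s')⟩
  · simp [prob, h]

theorem sum_prob_of_hasDist [Fintype S] {M : MarkovAutomaton S Act} {s : S} {a : Act} {μ : PMF S}
    (h : M.HasDist s a μ) : ∑ s', M.prob s a s' = 1 := by
  simp only [prob_eq h]
  have h1 : ∑ s', μ s' = 1 := by rw [← μ.tsum_coe, tsum_fintype]
  rw [← ENNReal.toReal_sum (fun s' _ => μ.apply_ne_top s'), h1]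
  simp

theorem sum_ofReal_prob [Fintype S] (M : MarkovAutomaton S Act) {s : S} {a : Act}
    (h : ∑ s', M.prob s a s' = 1) : ∑ s', ENNReal.ofReal (M.prob s a s') = 1 := by
  rw [← ENNReal.ofReal_sum_of_nonneg (fun s' _ => (M.prob_mem s a s').1), h, ENNReal.ofReal_one]

theorem sum_prob_markovian [Fintype S] (M : MarkovAutomaton S Act) {s : S} (hs : s ∈ M.MS) :
    ∑ s', M.prob s M.tau s' = 1 := by
  obtain ⟨r, μ, h⟩ := hs
  exact sum_prob_of_hasDist (Or.inr ⟨rfl, r, h⟩)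

theorem sum_prob_enabled [Fintype S] (M : MarkovAutomaton S Act) {s : S} {a : Act}
    (ha : a ∈ M.enabled s) : ∑ s', M.prob s a s' = 1 := by
  obtain ⟨s', hs'⟩ := ha
  by_cases h : ∃ μ, M.HasDist s a μ
  · exact sum_prob_of_hasDist h.choose_spec
  · simp [prob, h] at hs'

theorem sum_prob [Fintype S] (M : MarkovAutomaton S Act) (s : S) (a : Act) :
    ∑ s', M.prob s a s' = 0 ∨ ∑ s', M.prob s a s' = 1 := by
  by_cases h : ∃ μ, M.HasDist s a μ
  · exact Or.inr (sum_prob_of_hasDist h.choose_spec)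
  · left; simp [prob, h]

theorem mem_MS_of_not_mem_PS (M : MarkovAutomaton S Act) {s : S} (hs : s ∉ M.PS) : s ∈ M.MS :=
  (M.prob_or_markovian s).resolve_left hs

/-! ## Digitization of a Markov automaton -/

open Classical in
/-- The digitization of a Markov automaton with respect to the digitization constant `δ`. -/
def digitization [Fintype S] (M : MarkovAutomaton S Act) {δ : ℝ} (hδ : 0 < δ) : MDP S Act where
  init := M.init
  prob s a s' :=
    if s ∈ M.MS ∧ a = M.tau then
      if s = s' then
        M.prob s M.tau s' * (1 - Real.exp (-M.exitRate s * δ)) + Real.exp (-M.exitRate s * δ)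
      else M.prob s M.tau s' * (1 - Real.exp (-M.exitRate s * δ))
    else M.prob s a s'
  prob_mem s a s' := by
    split_ifs with h h'
    · have h1 := M.prob_mem s M.tau s'
      have h2 := Real.exp_pos (-M.exitRate s * δ)
      have h3 : Real.exp (-M.exitRate s * δ) ≤ 1 := by
        rw [Real.exp_le_one_iff]
        nlinarith [M.exitRate_pos h.1]
      constructor <;> nlinarith [h1.1, h1.2]
    · have h1 := M.prob_mem s M.tau s'
      have h2 := Real.exp_pos (-M.exitRate s * δ)
      have h3 : Real.exp (-M.exitRate s * δ) ≤ 1 := by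
        rw [Real.exp_le_one_iff]
        nlinarith [M.exitRate_pos h.1]
      constructor <;> nlinarith [h1.1, h1.2]
    · exact M.prob_mem s a s'
  sum_prob s a := by
    by_cases h : s ∈ M.MS ∧ a = M.tau
    · right
      simp only [h, and_self, if_true]
      have : ∀ s', (if s = s' then
          M.prob s M.tau s' * (1 - Real.exp (-M.exitRate s * δ)) + Real.exp (-M.exitRate s * δ)
        else M.prob s M.tau s' * (1 - Real.exp (-M.exitRate s * δ))) =
          M.prob s M.tau s' * (1 - Real.exp (-M.exitRate s * δ)) +
            (if s = s' then Real.exp (-M.exitRate s * δ) else 0) := by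
        intro s'; split_ifs <;> ring
      simp only [this, Finset.sum_add_distrib, ← Finset.sum_mul, M.sum_prob_markovian h.1]
      simp
    · simp only [h, if_false]
      exact M.sum_prob s a

/-! ## Paths -/

/-- The duration of the first `n` steps of a path. -/
def elapsed (ω : ℕ → Step S Act) (n : ℕ) : ℝ := ∑ i ∈ Finset.range n, Stamp.time (ω i).1

/-- The infinite paths of a Markov automaton: time diverges, transition probabilities are positive,
and the stamps match the types of the states. -/
def infPaths (M : MarkovAutomaton S Act) : Set (ℕ → Step S Act) :=
  {ω | Tendsto (elapsed ω) atTop atTop ∧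
    ∀ i, 0 < M.prob (pathState M.init ω i) (Stamp.action M.tau (ω i).1)
        (pathState M.init ω (i + 1)) ∧
      (pathState M.init ω i ∈ M.PS → ∃ a, (ω i).1 = Sum.inl a) ∧
      (pathState M.init ω i ∈ M.MS → ∃ t, (ω i).1 = Sum.inr t)}

/-! ## Schedulers and the induced probability measure -/

/-- The last state of a finite history of steps from the initial state. -/
def lastState (M : MarkovAutomaton S Act) : {n : ℕ} → (Fin n → Step S Act) → S
  | 0, _ => M.init
  | n + 1, h => (h (Fin.last n)).2

variable [MeasurableSpace S] [MeasurableSpace Act]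

/-- A (generic) scheduler: a measurable choice of a distribution over the actions that are enabled
in the last state of the observed finite timed path.  It is a total function on finite sequences of
steps; its values on sequences that are not finite paths are immaterial. -/
structure Scheduler (M : MarkovAutomaton S Act) where
  choice : (n : ℕ) → (Fin n → Step S Act) → PMF Act
  measurable_choice : ∀ n a, Measurable fun h => choice n h a
  enabled_of_choice : ∀ n h a, choice n h a ≠ 0 → a ∈ M.enabled (M.lastState h)

/-- The exponential distribution with rate `r` as a distribution of sojourn-time stamps. -/
def sojournLaw (Act : Type*) [MeasurableSpace Act] (r : ℝ) : Measure (Stamp Act) :=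
  (expMeasure r).map fun t => (Sum.inr t.toNNReal : Stamp Act)

open Classical in
/-- The law of the next step after the history `h` under the scheduler `σ`. -/
def stepMeasure [Fintype S] [Fintype Act] (M : MarkovAutomaton S Act) (σ : M.Scheduler) {n : ℕ}
    (h : Fin n → Step S Act) : Measure (Step S Act) :=
  if M.lastState h ∈ M.PS then
    ∑ a, ∑ s', (σ.choice n h a * ENNReal.ofReal (M.prob (M.lastState h) a s')) •
      Measure.dirac (Sum.inl a, s')
  else
    (sojournLaw Act (M.exitRate (M.lastState h))).prod
      (∑ s', ENNReal.ofReal (M.prob (M.lastState h) M.tau s') • Measure.dirac s')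


theorem isProbabilityMeasure_stepMeasure [Fintype S] [Fintype Act] (M : MarkovAutomaton S Act)
    (σ : M.Scheduler) {n : ℕ} (h : Fin n → Step S Act) :
    IsProbabilityMeasure (M.stepMeasure σ h) := by
  unfold stepMeasure
  split_ifs with hs
  · constructor
    have h1 : ∀ a, ∑ s', σ.choice n h a * ENNReal.ofReal (M.prob (M.lastState h) a s') =
        σ.choice n h a := by
      intro a
      rw [← Finset.mul_sum]
      by_cases ha : σ.choice n h a = 0
      · simp [ha]
      · rw [M.sum_ofReal_prob (M.sum_prob_enabled (σ.enabled_of_choice n h a ha)), mul_one]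
    have h2 : ∑ a, σ.choice n h a = 1 := by rw [← (σ.choice n h).tsum_coe, tsum_fintype]
    simp [Measure.finsetSum_apply, h1, h2]
  · have hm := M.mem_MS_of_not_mem_PS hs
    have h1 := isProbabilityMeasure_expMeasure (M.exitRate_pos hm)
    have h2 : IsProbabilityMeasure (sojournLaw Act (M.exitRate (M.lastState h))) :=
      Measure.isProbabilityMeasure_map
        (measurable_inr.comp measurable_real_toNNReal).aemeasurable
    have h3 : IsProbabilityMeasure (∑ s', ENNReal.ofReal (M.prob (M.lastState h) M.tau s') •
        (Measure.dirac s' : Measure S)) := by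
      constructor
      simp [Measure.finsetSum_apply, M.sum_ofReal_prob (M.sum_prob_markovian hm)]
    infer_instance

theorem measurable_lastState (M : MarkovAutomaton S Act) (n : ℕ) :
    Measurable (M.lastState : (Fin n → Step S Act) → S) := by
  cases n with
  | zero => exact measurable_const
  | succ n => exact measurable_snd.comp (measurable_pi_apply (Fin.last n))

theorem measurable_stepMeasure [Fintype S] [Fintype Act] [DiscreteMeasurableSpace S]
    (M : MarkovAutomaton S Act) (σ : M.Scheduler) (n : ℕ) :
    Measurable fun h : Fin n → Step S Act => M.stepMeasure σ h := by
  have hl := M.measurable_lastState n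
  refine Measurable.ite (hl (MeasurableSet.of_discrete (s := M.PS))) ?_ ?_
  · refine Measure.measurable_of_measurable_coe _ fun T _ => ?_
    simp only [Measure.finsetSum_apply, Measure.smul_apply, smul_eq_mul]
    refine Finset.measurable_sum _ fun a _ => Finset.measurable_sum _ fun s' _ => ?_
    refine Measurable.mul_const (Measurable.mul (σ.measurable_choice n a) ?_) _
    exact (Measurable.of_discrete
      (f := fun s => ENNReal.ofReal (M.prob s a s'))).comp hl
  · exact (Measurable.of_discrete
      (f := fun s => (sojournLaw Act (M.exitRate s)).prod
        (∑ s', ENNReal.ofReal (M.prob s M.tau s') • Measure.dirac s'))).comp hl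

/-- Reindexing of histories. -/
def historyOfIic {X : Type*} {n : ℕ} (h : Finset.Iic n → X) : Fin (n + 1) → X :=
  fun i => h ⟨i, Finset.mem_Iic.2 (Nat.lt_succ_iff.1 i.2)⟩

/-- The step law as a kernel from histories (of `n + 1` steps) to steps. -/
def stepKernel [Fintype S] [Fintype Act] [DiscreteMeasurableSpace S]
    (M : MarkovAutomaton S Act) (σ : M.Scheduler) (n : ℕ) :
    Kernel (Finset.Iic n → Step S Act) (Step S Act) where
  toFun h := M.stepMeasure σ (historyOfIic h)
  measurable' := (M.measurable_stepMeasure σ (n + 1)).comp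
    (measurable_pi_lambda _ fun _ => measurable_pi_apply _)

instance [Fintype S] [Fintype Act] [DiscreteMeasurableSpace S]
    (M : MarkovAutomaton S Act) (σ : M.Scheduler) (n : ℕ) : IsMarkovKernel (M.stepKernel σ n) :=
  ⟨fun h => M.isProbabilityMeasure_stepMeasure σ (historyOfIic h)⟩

/-- The probability measure on sequences of steps induced by the scheduler `σ`: the first step has
the law `stepMeasure` for the empty history, each further step the law `stepMeasure` given the
steps before it. -/
def pathMeasure [Fintype S] [Fintype Act] [DiscreteMeasurableSpace S]
    (M : MarkovAutomaton S Act) (σ : M.Scheduler) : Measure (ℕ → Step S Act) :=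
  Kernel.trajMeasure (X := fun _ => Step S Act)
    (M.stepMeasure σ (n := 0) Fin.elim0) (M.stepKernel σ)

instance [Fintype S] [Fintype Act] [DiscreteMeasurableSpace S]
    (M : MarkovAutomaton S Act) (σ : M.Scheduler) : IsProbabilityMeasure (M.pathMeasure σ) := by
  have := M.isProbabilityMeasure_stepMeasure σ (n := 0) Fin.elim0
  unfold pathMeasure
  infer_instance

/-- The automaton has no Zeno behaviour: under every scheduler, time diverges almost surely. -/
def NonZeno [Fintype S] [Fintype Act] [DiscreteMeasurableSpace S]
    (M : MarkovAutomaton S Act) : Prop :=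
  ∀ σ : M.Scheduler, ∀ᵐ ω ∂(M.pathMeasure σ), Tendsto (elapsed ω) atTop atTop

end MarkovAutomaton

/-! ## Time intervals -/

/-- Time intervals `[a, b]` and `[a, ∞)`. -/
inductive TimeInterval
  | bounded (a b : ℝ)
  | unbounded (a : ℝ)

namespace TimeInterval

/-- The infimum of the interval. -/
def lower : TimeInterval → ℝ
  | bounded a _ => a
  | unbounded a => a

/-- The interval as a set of real numbers. -/
def toSet : TimeInterval → Set ℝ
  | bounded a b => Set.Icc a b
  | unbounded a => Set.Ici a

/-- Well-formed time intervals for `δ`: `[a, b]` with `0 ≤ a < b`, or `[a, ∞)` with `0 ≤ a`, whose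
end points are natural multiples of `δ`. -/
def WellFormed (δ : ℝ) : TimeInterval → Prop
  | bounded a b => 0 ≤ a ∧ a < b ∧ (∃ j : ℕ, a / δ = j) ∧ ∃ k : ℕ, b / δ = k
  | unbounded a => 0 ≤ a ∧ ∃ j : ℕ, a / δ = j

/-- The digitization step bounds: all `n` with `n δ` in the interval, except for the lower end
point `a` of the interval if `a > 0`.  So `[jδ, kδ]` becomes `{j + 1, …, k}` and `[0, kδ]` becomes
`{0, …, k}`. -/
def digitize (δ : ℝ) (I : TimeInterval) : Set ℕ :=
  {n | (n : ℝ) * δ ∈ I.toSet ∧ ¬ (0 < I.lower ∧ (n : ℝ) * δ = I.lower)}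

/-- The lower error bound for maximal rate `lam` and digitization constant `δ`. -/
def lowerError (lam δ : ℝ) (I : TimeInterval) : ℝ :=
  if I.lower = 0 then 0
  else 1 - (1 + lam * δ) ^ (I.lower / δ) * Real.exp (-lam * I.lower)

/-- The upper error bound for maximal rate `lam` and digitization constant `δ`. -/
def upperError (lam δ : ℝ) : TimeInterval → ℝ
  | bounded a b => (1 - (1 + lam * δ) ^ (b / δ) * Real.exp (-lam * b)) +
      (if a = 0 then 0 else 1 - Real.exp (-lam * δ))
  | unbounded a => if a = 0 then 0 else 1 - Real.exp (-lam * δ)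

end TimeInterval

/-! ## Timed reachability and reachability bounded by digitization steps -/

namespace MarkovAutomaton

variable {S Act : Type*}

/-- The infinite paths that visit `G` within the time interval `I`. -/
def timedReach (M : MarkovAutomaton S Act) (I : TimeInterval) (G : Set S) :
    Set (ℕ → Step S Act) :=
  {ω | ω ∈ M.infPaths ∧ ∃ n, pathState M.init ω n ∈ G ∧
    (I.toSet ∩ Set.Icc (elapsed ω n) (elapsed ω n + Stamp.time (ω n).1)).Nonempty}

/-- The number of full periods of length `δ` spent in the `i`-th state: the largest `m` with
`m δ ≤ t`, where `t` is the sojourn time. -/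
def waitSteps (δ : ℝ) (ω : ℕ → Step S Act) (i : ℕ) : ℕ := ⌊Stamp.time (ω i).1 / δ⌋₊

/-- The position in the digitized path at which the `i`-th state of `ω` is entered: step `i` of
`ω` is replaced by `waitSteps δ ω i` self-loops followed by the step itself. -/
def offset (δ : ℝ) (ω : ℕ → Step S Act) (i : ℕ) : ℕ :=
  ∑ l ∈ Finset.range i, (waitSteps δ ω l + 1)

/-- The index `i` with `offset δ ω i ≤ p < offset δ ω (i + 1)`. -/
def blockIndex (δ : ℝ) (ω : ℕ → Step S Act) (p : ℕ) : ℕ :=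
  Nat.findGreatest (fun i => offset δ ω i ≤ p) p

/-- The digitization of an infinite path. Its step at position `p` in block `i` carries the action
of step `i` of `ω`; it is a self-loop at the `i`-th state, except for the last step of the block,
which moves on to the next state. -/
def digitizePath (M : MarkovAutomaton S Act) (δ : ℝ) (ω : ℕ → Step S Act) : ℕ → Act × S :=
  fun p =>
    let i := blockIndex δ ω p
    (Stamp.action M.tau (ω i).1,
      if p + 1 < offset δ ω (i + 1) then pathState M.init ω i else pathState M.init ω (i + 1))

open Classical in
/-- The number of digitization steps among the first `n` steps of a digital path, i.e. of
transitions that emerge from Markovian states. -/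
def dsCount (M : MarkovAutomaton S Act) (ω : ℕ → Act × S) (n : ℕ) : ℕ :=
  ((Finset.range n).filter fun i => pathState M.init ω i ∈ M.MS).card

/-- The infinite paths of the digitization that visit `G` after a number of digitization steps
that lies in `J`. -/
def dsReach [Fintype S] (M : MarkovAutomaton S Act) {δ : ℝ} (hδ : 0 < δ) (J : Set ℕ)
    (G : Set S) : Set (ℕ → Act × S) :=
  {ω | ω ∈ (M.digitization hδ).infPaths ∧
    ∃ n, pathState M.init ω n ∈ G ∧ M.dsCount ω n ∈ J}

/-- The paths of the automaton whose digitization belongs to a set of infinite digital paths. -/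
def inducedPaths (M : MarkovAutomaton S Act) (δ : ℝ) (D : Set (ℕ → Act × S)) :
    Set (ℕ → Step S Act) :=
  {ω | ω ∈ M.infPaths ∧ M.digitizePath δ ω ∈ D}

/-- The length of the longest prefix of `ω` with duration at most `t`. -/
def lengthUpTo (ω : ℕ → Step S Act) (t : ℝ) : ℕ := sSup {n | elapsed ω n ≤ t}

/-- The infinite paths whose prefix up to time `t` has more than `k` digitization steps; the
digitization of the prefix of length `n` consists of the first `offset δ ω n` steps of the
digitization of `ω`. -/
def manySteps (M : MarkovAutomaton S Act) (δ t : ℝ) (k : ℕ) : Set (ℕ → Step S Act) :=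
  {ω | ω ∈ M.infPaths ∧
    k < M.dsCount (M.digitizePath δ ω) (offset δ ω (lengthUpTo ω t))}

end MarkovAutomaton

end

noncomputable section

/-! A stay of length t in a Markovian state costs ⌊t/δ⌋ + 1 digitization steps, so the elapsed time
`durSum` is at most δ times the count `stepCount`: the digital clock can only run ahead. Timed and
digital reachability can therefore disagree for two reasons only. Either the clock overruns, i.e.
more than k steps are completed by time kδ; or, when a = jδ > 0, step j + 1 leaves a state, so that
the digital path is never seen in that state at a count above j although the real stay reaches time
a. The inclusions `inducedPaths_subset` and `timedReach_subset` express this path by path.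
Afterwards only monotonicity and subadditivity of the measure are used, so the reachability events
need not be measurable.

Overrun. (1 + λδ)^k e^{-λkδ} is the probability that a Poisson process of rate λ has at most one
point in each of k periods. With elapsed time T and c steps used, the value e^{-λ(kδ-T)}(1 +
λδ)^{k-c} is preserved on average by a stay of rate λ and does not decrease on average for a smaller
rate (`le_lintegral_expMeasure`, resting on `one_add_mul_pow_le`). With the boundary values 0 after
an overrun and 1 after the deadline, it is a submartingale under every scheduler, bounded by the
indicator of no overrun; its initial value is thus a lower bound for the probability of no overrun
(`measure_stepCount_gt_le`).

Leaving step. Condition on the stay that contains step j + 1. By memorylessness, that stay ends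
within this period with probability 1 - e^{-Eδ} ≤ 1 - e^{-λδ}. The events indexed by the stay are
disjoint, so the bound survives summation (`measure_stepCount_eq_le`). -/

theorem Stamp.measurable_time {Act : Type*} [MeasurableSpace Act] :
    Measurable (Stamp.time : Stamp Act → ℝ) := by
  refine measurable_fun_sum ?_ ?_
  · exact measurable_const
  · exact measurable_coe_nnreal_real

theorem Stamp.time_nonneg {Act : Type*} (x : Stamp Act) : 0 ≤ x.time := by
  cases x with
  | inl a => exact le_rfl
  | inr t => exact t.2

/-! ### Sojourn times as random variables on the path space -/

namespace MarkovAutomaton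

variable {S Act : Type*}

/-- The law of the time spent in the state `s`; probabilistic states are left immediately. -/
def durLaw (M : MarkovAutomaton S Act) (s : S) : Measure ℝ :=
  open Classical in
  if s ∈ M.MS then (expMeasure (M.exitRate s)).map (fun t => max t 0) else Measure.dirac 0

open Classical in
/-- The time spent in the `n`-th state, where stamps in probabilistic states are ignored. -/
def dur (M : MarkovAutomaton S Act) (ω : ℕ → Step S Act) (n : ℕ) : ℝ :=
  if pathState M.init ω n ∈ M.MS then (ω n).1.time else 0

theorem isProbabilityMeasure_durLaw (M : MarkovAutomaton S Act) (s : S) :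
    IsProbabilityMeasure (M.durLaw s) := by
  unfold durLaw
  split_ifs with h
  · have := isProbabilityMeasure_expMeasure (M.exitRate_pos h)
    exact Measure.isProbabilityMeasure_map (by fun_prop)
  · infer_instance

theorem lastState_eq (M : MarkovAutomaton S Act) (ω : ℕ → Step S Act) (n : ℕ) :
    M.lastState (fun i : Fin n => ω i) = pathState M.init ω n := by
  cases n <;> rfl

/-- `DependsOn` on `Set.Iio n` plays the role of adaptedness: it lets a quantity be treated as known
when step `n` is integrated out. -/
theorem dependsOn_pathState {L : Type*} (s₀ : S) (n : ℕ) :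
    DependsOn (fun ω : ℕ → L × S => pathState s₀ ω n) (Set.Iio n) := by
  intro x y h
  cases n with
  | zero => rfl
  | succ n => simp [pathState, h n (Set.mem_Iio.2 n.lt_succ_self)]

theorem dur_nonneg (M : MarkovAutomaton S Act) (ω : ℕ → Step S Act) (n : ℕ) : 0 ≤ M.dur ω n := by
  unfold dur
  split_ifs
  exacts [Stamp.time_nonneg _, le_rfl]

theorem measurable_pathState [MeasurableSpace S] [MeasurableSpace Act] (M : MarkovAutomaton S Act) (n : ℕ) :
    Measurable fun ω : ℕ → Step S Act => pathState M.init ω n := by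
  cases n with
  | zero => exact measurable_const
  | succ n => exact measurable_snd.comp (measurable_pi_apply n)

variable [Fintype S] [Fintype Act]
  [MeasurableSpace S] [DiscreteMeasurableSpace S] [MeasurableSpace Act]

/-- This is the disintegration built into the Ionescu-Tulcea construction. The first step is
separate because it comes from the initial law, while later steps come from kernels on
`Finset.Iic`-indexed histories. -/
theorem lintegral_pathMeasure_succ (M : MarkovAutomaton S Act) (σ : M.Scheduler) (n : ℕ)
    {Φ : (Fin n → Step S Act) × Step S Act → ENNReal} (hΦ : Measurable Φ) :
    ∫⁻ ω, Φ (fun i => ω i, ω n) ∂M.pathMeasure σ =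
      ∫⁻ ω, ∫⁻ y, Φ (fun i => ω i, y) ∂M.stepMeasure σ (fun i : Fin n => ω i)
        ∂M.pathMeasure σ := by
  have h0 := M.isProbabilityMeasure_stepMeasure σ (n := 0) Fin.elim0
  cases n with
  | zero =>
    have hΦ' : Measurable fun y => Φ (Fin.elim0, y) := hΦ.comp (by fun_prop)
    have e : ∀ ω : ℕ → Step S Act, (fun i : Fin 0 => ω i) = Fin.elim0 := fun ω =>
      Subsingleton.elim _ _
    simp only [e, lintegral_const, measure_univ, mul_one]
    have hmap : (M.pathMeasure σ).map (fun ω => ω 0) = M.stepMeasure σ (n := 0) Fin.elim0 := by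
      have h1 : (fun ω : ℕ → Step S Act => ω 0) =
          (MeasurableEquiv.piUnique (fun _ : Finset.Iic 0 => Step S Act)) ∘
            (Preorder.frestrictLe (π := fun _ => Step S Act) 0) := by
        funext ω; rfl
      rw [h1, ← Measure.map_map (by fun_prop) (by fun_prop), pathMeasure, Kernel.trajMeasure,
        Measure.map_comp _ _ (by fun_prop), Kernel.traj_map_frestrictLe,
        Kernel.partialTraj_self, Measure.id_comp, Measure.map_map (by fun_prop) (by fun_prop)]
      exact Measure.map_id
    rw [← hmap, lintegral_map hΦ' (by fun_prop)]
  | succ n =>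
    set r : (Finset.Iic n → Step S Act) → (Fin (n + 1) → Step S Act) := historyOfIic with hr
    have hrm : Measurable r := measurable_pi_lambda _ fun _ => measurable_pi_apply _
    have key := Kernel.map_frestrictLe_trajMeasure_compProd_eq_map_trajMeasure
      (X := fun _ => Step S Act) (μ₀ := M.stepMeasure σ (n := 0) Fin.elim0)
      (κ := M.stepKernel σ) (a := n)
    have hΨ : Measurable fun p : (Finset.Iic n → Step S Act) × Step S Act => Φ (r p.1, p.2) :=
      hΦ.comp (by fun_prop)
    have e := congrArg (fun ν => ∫⁻ p, Φ (r p.1, p.2) ∂ν) key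
    have : IsProbabilityMeasure (Kernel.trajMeasure (X := fun _ => Step S Act)
      (M.stepMeasure σ (n := 0) Fin.elim0) (M.stepKernel σ)) := by infer_instance
    rw [Measure.lintegral_compProd hΨ, lintegral_map hΨ.lintegral_kernel_prod_right (by fun_prop),
      lintegral_map hΨ (by fun_prop)] at e
    exact e.symm

-- The scheduler drops out: in a Markovian state the stamp is the first marginal of a product law,
-- and in a probabilistic state the integrand is constant.
open Classical in
theorem lintegral_stepMeasure (M : MarkovAutomaton S Act) (σ : M.Scheduler) {n : ℕ}
    (h : Fin n → Step S Act) {f : ℝ → ENNReal} (hf : Measurable f) :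
    ∫⁻ y, f (if M.lastState h ∈ M.MS then y.1.time else 0) ∂M.stepMeasure σ h =
      ∫⁻ t, f t ∂M.durLaw (M.lastState h) := by
  have hp := M.isProbabilityMeasure_stepMeasure σ h
  by_cases hs : M.lastState h ∈ M.MS
  · have hs' : M.lastState h ∉ M.PS := fun h' => M.not_prob_and_markovian _ ⟨h', hs⟩
    have := isProbabilityMeasure_expMeasure (M.exitRate_pos hs)
    have h3 : IsProbabilityMeasure (∑ s', ENNReal.ofReal (M.prob (M.lastState h) M.tau s') •
        (Measure.dirac s' : Measure S)) := by
      constructor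
      simp [Measure.finsetSum_apply, M.sum_ofReal_prob (M.sum_prob_markovian hs)]
    have hm : Measurable fun t : ℝ => (Sum.inr t.toNNReal : Stamp Act) :=
      measurable_inr.comp measurable_real_toNNReal
    have : IsProbabilityMeasure (sojournLaw Act (M.exitRate (M.lastState h))) :=
      Measure.isProbabilityMeasure_map hm.aemeasurable
    simp only [hs, if_true, stepMeasure, hs', if_false, durLaw]
    rw [(measurePreserving_fst (μ := sojournLaw Act (M.exitRate (M.lastState h)))
      (ν := ∑ s', ENNReal.ofReal (M.prob (M.lastState h) M.tau s') •
        (Measure.dirac s' : Measure S))).lintegral_comp (f := fun x => f (Stamp.time x))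
        (hf.comp Stamp.measurable_time), sojournLaw,
      lintegral_map (f := fun x => f (Stamp.time x)) (hf.comp Stamp.measurable_time) hm,
      lintegral_map hf (by fun_prop)]
    rfl
  · simp [hs, durLaw, lintegral_dirac' _ hf]

/-- Integration of a function of the past and of the next sojourn time. -/
theorem lintegral_dur (M : MarkovAutomaton S Act) (σ : M.Scheduler) (n : ℕ) {X : Type*}
    [MeasurableSpace X] {A : (ℕ → Step S Act) → X} (hA : Measurable A)
    (hdep : DependsOn A (Set.Iio n)) {f : X → ℝ → ENNReal} (hf : Measurable (Function.uncurry f)) :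
    ∫⁻ ω, f (A ω) (M.dur ω n) ∂M.pathMeasure σ =
      ∫⁻ ω, ∫⁻ t, f (A ω) t ∂M.durLaw (pathState M.init ω n) ∂M.pathMeasure σ := by
  classical
  -- Pads a history to a full sequence so that `A` can be evaluated on it; the padding is arbitrary
  -- because `A` depends on the first `n` steps only.
  let ext : (Fin n → Step S Act) → ℕ → Step S Act := fun h i =>
    if hi : i < n then h ⟨i, hi⟩ else (Sum.inr 0, M.init)
  have hext : Measurable ext := by
    refine measurable_pi_lambda _ fun i => ?_
    by_cases hi : i < n
    · simpa [ext, hi] using measurable_pi_apply _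
    · simp [ext, hi]
  have hAe : ∀ ω, A (ext fun i => ω i) = A ω := fun ω => hdep fun i hi => by
    simp [ext, Set.mem_Iio.1 hi]
  have hl := M.measurable_lastState n
  have hg : Measurable fun p : (Fin n → Step S Act) × Step S Act =>
      if M.lastState p.1 ∈ M.MS then p.2.1.time else 0 := by
    refine Measurable.ite ((hl.comp measurable_fst) (MeasurableSet.of_discrete (s := M.MS))) ?_ ?_
    · exact Stamp.measurable_time.comp (by fun_prop)
    · exact measurable_const
  have hΦ : Measurable fun p : (Fin n → Step S Act) × Step S Act =>
      f (A (ext p.1)) (if M.lastState p.1 ∈ M.MS then p.2.1.time else 0) :=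
    hf.comp ((hA.comp (hext.comp measurable_fst)).prodMk hg)
  have e := M.lintegral_pathMeasure_succ σ n hΦ
  simp only [hAe, lastState_eq] at e
  refine e.trans (lintegral_congr fun ω => ?_)
  have := M.lintegral_stepMeasure σ (fun i : Fin n => ω i) (f := f (A ω)) (by fun_prop)
  rwa [lastState_eq] at this

theorem measurable_dur (M : MarkovAutomaton S Act) (n : ℕ) :
    Measurable fun ω : ℕ → Step S Act => M.dur ω n := by
  classical
  refine Measurable.ite (M.measurable_pathState n (MeasurableSet.of_discrete (s := M.MS))) ?_
    measurable_const
  exact Stamp.measurable_time.comp (measurable_fst.comp (measurable_pi_apply n))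

end MarkovAutomaton

/-! ### Estimates for one exponential sojourn -/

/-- The discrete estimate behind the bound on the number of digitization steps. -/
theorem one_add_mul_pow_le {r lam δ : ℝ} (hr : 0 ≤ r) (hle : r ≤ lam) (hδ : 0 ≤ δ) (j : ℕ) :
    (1 + lam * δ) ^ j ≤ Real.exp ((lam - r) * (j * δ)) +
      ∑ m ∈ Finset.range j,
        δ * (r * ((1 + lam * δ) ^ (j - (m + 1)) * Real.exp ((lam - r) * (m * δ)))) := by
  induction j with
  | zero => simp
  | succ j ih =>
    have hx : 0 ≤ lam * δ := mul_nonneg (hr.trans hle) hδ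
    have hsum : ∑ m ∈ Finset.range j,
        δ * (r * ((1 + lam * δ) ^ (j + 1 - (m + 1)) * Real.exp ((lam - r) * (m * δ)))) =
        (1 + lam * δ) * ∑ m ∈ Finset.range j,
        δ * (r * ((1 + lam * δ) ^ (j - (m + 1)) * Real.exp ((lam - r) * (m * δ)))) := by
      rw [Finset.mul_sum]
      refine Finset.sum_congr rfl fun m hm => ?_
      have : j + 1 - (m + 1) = (j - (m + 1)) + 1 := by have := Finset.mem_range.1 hm; omega
      rw [this, pow_succ]
      ring
    rw [Finset.sum_range_succ, hsum, pow_succ]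
    have he : Real.exp ((lam - r) * (((j + 1 : ℕ) : ℝ) * δ)) =
        Real.exp ((lam - r) * (j * δ)) * Real.exp ((lam - r) * δ) := by
      rw [← Real.exp_add]
      push_cast
      ring_nf
    rw [he]
    -- Multiplying the induction hypothesis by 1 + λδ leaves (1 + (λ - r)δ) e^{(λ-r)jδ} ≤
    -- e^{(λ-r)(j+1)δ} to show; the new summand supplies the missing rδ e^{(λ-r)jδ}.
    have h1 := Real.add_one_le_exp ((lam - r) * δ)
    have h2 := mul_le_mul_of_nonneg_left h1 (Real.exp_pos ((lam - r) * (j * δ))).le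
    have h3 := mul_le_mul_of_nonneg_left ih (by linarith : 0 ≤ 1 + lam * δ)
    simp only [Nat.sub_self, pow_zero, one_mul]
    nlinarith

theorem expMeasure_eq_withDensity (r : ℝ) :
    expMeasure r = volume.withDensity (exponentialPDF r) := rfl

theorem measurable_exponentialPDF (r : ℝ) : Measurable (exponentialPDF r) :=
  (measurable_exponentialPDFReal r).ennreal_ofReal

theorem expMeasure_Ioi {r : ℝ} (hr : 0 < r) {a : ℝ} (ha : 0 ≤ a) :
    expMeasure r (Set.Ioi a) = ENNReal.ofReal (Real.exp (-(r * a))) := by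
  have := isProbabilityMeasure_expMeasure hr
  rw [← Set.compl_Iic, prob_compl_eq_one_sub measurableSet_Iic, ← ofReal_cdf,
    cdf_expMeasure_eq hr, if_pos ha, ← ENNReal.ofReal_one, ← ENNReal.ofReal_sub]
  · simp
  · simp only [sub_nonneg, Real.exp_le_one_iff, Left.neg_nonpos_iff]
    positivity

theorem expMeasure_Ici {r : ℝ} (hr : 0 < r) {a : ℝ} (ha : 0 ≤ a) :
    expMeasure r (Set.Ici a) = ENNReal.ofReal (Real.exp (-(r * a))) := by
  rw [← expMeasure_Ioi hr ha, expMeasure_eq_withDensity]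
  exact measure_congr (withDensity_absolutelyContinuous _ _ Ioi_ae_eq_Ici.symm)

/-- A lower bound for the integral of the value after an exponentially distributed sojourn time,
with time budget `u` and step budget `j`. -/
theorem le_lintegral_expMeasure {r lam δ u : ℝ} (hr : 0 < r) (hle : r ≤ lam) (hδ : 0 < δ) {j : ℕ}
    (hu : j * δ ≤ u) {g : ℝ → ENNReal} (hg : Measurable g) (hg1 : ∀ t, u < t → 1 ≤ g t)
    (hg2 : ∀ t, 0 ≤ t → t ≤ u → ⌊t / δ⌋₊ < j → ENNReal.ofReal
      (Real.exp (-(lam * (u - t))) * (1 + lam * δ) ^ (j - (⌊t / δ⌋₊ + 1))) ≤ g t) :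
    ENNReal.ofReal (Real.exp (-(lam * u)) * (1 + lam * δ) ^ j) ≤ ∫⁻ t, g t ∂expMeasure r := by
  have hx : 0 < 1 + lam * δ := by nlinarith
  have hu0 : 0 ≤ u := le_trans (by positivity) hu
  -- Lower bound for density times value during period m: r e^{-rt} e^{-λ(u-t)} = r e^{-λu}
  -- e^{(λ-r)t}, which is smallest at t = mδ because r ≤ λ.
  set c : ℕ → ℝ := fun m =>
    r * (Real.exp (-(lam * u)) * ((1 + lam * δ) ^ (j - (m + 1)) *
      Real.exp ((lam - r) * (m * δ)))) with hc
  have hc0 : ∀ m, 0 ≤ c m := fun m => by positivity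
  -- Since jδ ≤ u, the first j periods end before the deadline and are disjoint from the event t >
  -- u. The times between jδ and u, where the budget is exhausted, contribute nothing.
  have hpt : ∀ t, (Set.Ioi u).indicator (exponentialPDF r) t +
      ∑ m ∈ Finset.range j, (Set.Ico (m * δ) ((m + 1) * δ)).indicator
        (fun _ => ENNReal.ofReal (c m)) t ≤ exponentialPDF r t * g t := by
    intro t
    by_cases h1 : u < t
    · rw [Set.indicator_of_mem (Set.mem_Ioi.2 h1), Finset.sum_eq_zero, add_zero]
      · exact le_mul_of_one_le_right' (hg1 t h1)
      · intro m hm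
        refine Set.indicator_of_notMem (fun h => ?_) _
        have hm' : ((m + 1 : ℕ) : ℝ) ≤ j := Nat.cast_le.2 (Finset.mem_range.1 hm)
        push_cast at hm'
        have := mul_le_mul_of_nonneg_right hm' hδ.le
        linarith [h.2]
    · rw [Set.indicator_of_notMem (by simpa using h1), zero_add]
      by_cases h2 : 0 ≤ t ∧ ⌊t / δ⌋₊ < j
      · obtain ⟨h2, h3⟩ := h2
        have hfl : (⌊t / δ⌋₊ : ℝ) * δ ≤ t := by
          have := Nat.floor_le (div_nonneg h2 hδ.le)
          rwa [le_div_iff₀ hδ] at this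
        rw [Finset.sum_eq_single ⌊t / δ⌋₊]
        · refine (Set.indicator_le_self _ _ _).trans ?_
          refine le_trans ?_ (mul_le_mul_right (hg2 t h2 (not_lt.1 h1) h3) _)
          rw [exponentialPDF_of_nonneg h2, ← ENNReal.ofReal_mul (by positivity)]
          refine ENNReal.ofReal_le_ofReal ?_
          have he : Real.exp (-(lam * u)) * Real.exp ((lam - r) * (⌊t / δ⌋₊ * δ)) ≤
              Real.exp (-(r * t)) * Real.exp (-(lam * (u - t))) := by
            rw [← Real.exp_add, ← Real.exp_add, Real.exp_le_exp]
            nlinarith [mul_le_mul_of_nonneg_left hfl (sub_nonneg.2 hle)]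
          have := mul_le_mul_of_nonneg_left he
            (by positivity : 0 ≤ r * (1 + lam * δ) ^ (j - (⌊t / δ⌋₊ + 1)))
          simp only [hc]
          linarith
        · intro m _ hne
          refine Set.indicator_of_notMem (fun h => hne ?_) _
          refine ((Nat.floor_eq_iff (div_nonneg h2 hδ.le)).2 ⟨?_, ?_⟩).symm
          · exact (le_div_iff₀ hδ).2 h.1
          · exact (div_lt_iff₀ hδ).2 h.2
        · intro h
          exact absurd (Finset.mem_range.2 h3) h
      · rw [Finset.sum_eq_zero]
        · exact zero_le
        · intro m hm
          refine Set.indicator_of_notMem (fun h => h2 ⟨?_, ?_⟩) _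
          · exact le_trans (by positivity) h.1
          · have ht : 0 ≤ t := le_trans (by positivity) h.1
            refine (Nat.floor_lt (div_nonneg ht hδ.le)).2 ((div_lt_iff₀ hδ).2 (h.2.trans_le ?_))
            have hm' : ((m + 1 : ℕ) : ℝ) ≤ j := Nat.cast_le.2 (Finset.mem_range.1 hm)
            push_cast at hm'
            exact mul_le_mul_of_nonneg_right hm' hδ.le
  rw [expMeasure_eq_withDensity,
    lintegral_withDensity_eq_lintegral_mul _ (measurable_exponentialPDF r) hg]
  refine le_trans ?_ (lintegral_mono hpt)
  rw [lintegral_add_left ((measurable_exponentialPDF r).indicator measurableSet_Ioi),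
    lintegral_indicator measurableSet_Ioi, ← withDensity_apply _ measurableSet_Ioi,
    ← expMeasure_eq_withDensity, expMeasure_Ioi hr hu0,
    lintegral_finsetSum _ fun m _ => measurable_const.indicator measurableSet_Ico]
  simp only [lintegral_indicator_const measurableSet_Ico, Real.volume_Ico]
  have hv : ∀ m : ℕ, ENNReal.ofReal (c m) *
      ENNReal.ofReal (((m : ℝ) + 1) * δ - m * δ) = ENNReal.ofReal (c m * δ) := fun m => by
    rw [ENNReal.ofReal_mul (hc0 m)]
    congr 2
    ring
  simp only [hv]
  rw [← ENNReal.ofReal_sum_of_nonneg fun m _ => mul_nonneg (hc0 m) hδ.le,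
    ← ENNReal.ofReal_add (Real.exp_pos _).le
      (Finset.sum_nonneg fun m _ => mul_nonneg (hc0 m) hδ.le)]
  refine ENNReal.ofReal_le_ofReal ?_
  -- After the factor e^{-λu} is taken out, exactly the discrete estimate remains, with e^{(λ-r)u}
  -- in place of the smaller e^{(λ-r)jδ}.
  have h1 := one_add_mul_pow_le hr.le hle hδ.le j
  have h2 : Real.exp ((lam - r) * (j * δ)) ≤ Real.exp ((lam - r) * u) :=
    Real.exp_le_exp.2 (mul_le_mul_of_nonneg_left hu (sub_nonneg.2 hle))
  have h3 : Real.exp (-(r * u)) = Real.exp (-(lam * u)) * Real.exp ((lam - r) * u) := by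
    rw [← Real.exp_add]
    ring_nf
  have h4 : ∑ m ∈ Finset.range j, c m * δ = Real.exp (-(lam * u)) * ∑ m ∈ Finset.range j,
      δ * (r * ((1 + lam * δ) ^ (j - (m + 1)) * Real.exp ((lam - r) * (m * δ)))) := by
    rw [Finset.mul_sum]
    exact Finset.sum_congr rfl fun m _ => by simp only [hc]; ring
  rw [h3, h4, ← mul_add]
  exact mul_le_mul_of_nonneg_left (by linarith) (Real.exp_pos _).le

/-! ### The number of full periods in one sojourn -/

namespace MarkovAutomaton

variable {S Act : Type*}

theorem ae_durLaw_nonneg (M : MarkovAutomaton S Act) (s : S) : ∀ᵐ t ∂M.durLaw s, 0 ≤ t := by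
  unfold durLaw
  split_ifs with h
  · rw [ae_map_iff (by fun_prop) measurableSet_Ici]
    exact ae_of_all _ fun t => le_max_right _ _
  · rw [ae_dirac_iff measurableSet_Ici]

theorem durLaw_le_floor (M : MarkovAutomaton S Act) {s : S} (hs : s ∈ M.MS) {δ : ℝ} (hδ : 0 < δ)
    (q : ℕ) : M.durLaw s {t | q ≤ ⌊t / δ⌋₊} =
      ENNReal.ofReal (Real.exp (-(M.exitRate s * (q * δ)))) := by
  have hE := M.exitRate_pos hs
  have hm : MeasurableSet {t : ℝ | q ≤ ⌊t / δ⌋₊} :=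
    measurableSet_le measurable_const (Nat.measurable_floor.comp (by fun_prop))
  rw [durLaw, if_pos hs, Measure.map_apply (by fun_prop) hm]
  have e : (fun t : ℝ => max t 0) ⁻¹' {t | q ≤ ⌊t / δ⌋₊} = {t | q * δ ≤ max t 0} := by
    ext t
    simp only [Set.mem_preimage, Set.mem_ofPred_eq]
    rw [Nat.le_floor_iff (div_nonneg (le_max_right _ _) hδ.le), le_div_iff₀ hδ]
  rw [e]
  -- For `q = 0` the truncation at 0 makes the set all of ℝ, not a half-line.
  rcases Nat.eq_zero_or_pos q with rfl | hq
  · have := isProbabilityMeasure_expMeasure hE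
    simp
  · have hq' : 0 < (q : ℝ) * δ := by positivity
    have : {t : ℝ | q * δ ≤ max t 0} = Set.Ici (q * δ) := by
      ext t
      simp [not_le.2 hq']
    rw [this, expMeasure_Ici hE hq'.le]

/-- Given that at least `q` periods are spent in a Markovian state, the probability to leave it in
the next period is at most the one for the rate `lam`. -/
theorem durLaw_floor_eq_le (M : MarkovAutomaton S Act) {s : S} (hs : s ∈ M.MS) {lam δ : ℝ}
    (hδ : 0 < δ) (hle : M.exitRate s ≤ lam) (q : ℕ) :
    M.durLaw s {t | ⌊t / δ⌋₊ = q} ≤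
      ENNReal.ofReal (1 - Real.exp (-lam * δ)) * M.durLaw s {t | q ≤ ⌊t / δ⌋₊} := by
  have hE := M.exitRate_pos hs
  have := M.isProbabilityMeasure_durLaw s
  have hm : ∀ q, MeasurableSet {t : ℝ | q ≤ ⌊t / δ⌋₊} := fun q =>
    measurableSet_le measurable_const (Nat.measurable_floor.comp (by fun_prop))
  have e : {t : ℝ | ⌊t / δ⌋₊ = q} = {t | q ≤ ⌊t / δ⌋₊} \ {t | q + 1 ≤ ⌊t / δ⌋₊} := by
    ext t
    simp only [Set.mem_ofPred_eq, Set.mem_sdiff]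
    omega
  have h1 : Real.exp (-lam * δ) ≤ Real.exp (-M.exitRate s * δ) :=
    Real.exp_le_exp.2 (by nlinarith)
  have h2 : Real.exp (-lam * δ) ≤ 1 := Real.exp_le_one_iff.2 (by nlinarith)
  have hsub : {t : ℝ | q + 1 ≤ ⌊t / δ⌋₊} ⊆ {t : ℝ | q ≤ ⌊t / δ⌋₊} := fun t h =>
    (Nat.le_succ q).trans h
  rw [e, measure_sdiff hsub (hm _).nullMeasurableSet (measure_ne_top _ _), M.durLaw_le_floor hs hδ,
    M.durLaw_le_floor hs hδ, ← ENNReal.ofReal_sub _ (Real.exp_pos _).le,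
    ← ENNReal.ofReal_mul (sub_nonneg.2 h2)]
  refine ENNReal.ofReal_le_ofReal ?_
  have h3 : Real.exp (-(M.exitRate s * (((q + 1 : ℕ) : ℝ) * δ))) =
      Real.exp (-(M.exitRate s * (q * δ))) * Real.exp (-M.exitRate s * δ) := by
    rw [← Real.exp_add]
    push_cast
    ring_nf
  rw [h3]
  nlinarith [Real.exp_pos (-(M.exitRate s * (q * δ)))]

end MarkovAutomaton

/-! ### The value of a step budget -/

/-- A lower bound for the probability that, after time `T` and `c` digitization steps, at most `k`
digitization steps are completed within time `k δ`. -/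
def budgetValue (lam δ : ℝ) (k : ℕ) (T : ℝ) (c : ℕ) : ENNReal :=
  if k < c then 0
  else if k * δ < T then 1
  else ENNReal.ofReal (Real.exp (-(lam * (k * δ - T))) * (1 + lam * δ) ^ (k - c))

/-- From 1 + x ≤ e^x the value is at most e^{λ(T - cδ)}. The hypothesis, that the digital clock is
not behind, is required only before the deadline, where it is an invariant of paths. -/
theorem budgetValue_le_one {lam δ : ℝ} (hlam : 0 ≤ lam) (hδ : 0 < δ) {k : ℕ} {T : ℝ} {c : ℕ}
    (hT : T ≤ k * δ → T ≤ c * δ) : budgetValue lam δ k T c ≤ 1 := by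
  unfold budgetValue
  split_ifs with h1 h2
  · exact zero_le
  · exact le_rfl
  · rw [ENNReal.ofReal_le_one]
    have h3 : (1 + lam * δ) ^ (k - c) ≤ Real.exp (lam * ((k - c : ℕ) * δ)) := by
      have := Real.add_one_le_exp (lam * δ)
      calc (1 + lam * δ) ^ (k - c) ≤ Real.exp (lam * δ) ^ (k - c) :=
            pow_le_pow_left₀ (by positivity) (by linarith) _
        _ = _ := by rw [← Real.exp_nat_mul]; ring_nf
    refine (mul_le_mul_of_nonneg_left h3 (Real.exp_pos _).le).trans ?_
    rw [← Real.exp_add, Real.exp_le_one_iff, Nat.cast_sub (not_lt.1 h1)]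
    have := mul_le_mul_of_nonneg_left (hT (not_lt.1 h2)) hlam
    nlinarith

theorem measurable_budgetValue (lam δ : ℝ) (k : ℕ) :
    Measurable fun p : ℝ × ℕ => budgetValue lam δ k p.1 p.2 := by
  refine measurable_from_prod_countable_left fun c => ?_
  show Measurable fun T => budgetValue lam δ k T c
  unfold budgetValue
  refine Measurable.ite (MeasurableSet.const _) measurable_const ?_
  refine Measurable.ite measurableSet_Ioi measurable_const ?_
  fun_prop

/-! ### Elapsed time and step count along a path -/

namespace MarkovAutomaton

variable {S Act : Type*}

open Classical in
/-- The number of digitization steps for a stay of duration `t` in the state `s`. -/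
def stepCost (M : MarkovAutomaton S Act) (δ : ℝ) (s : S) (t : ℝ) : ℕ :=
  if s ∈ M.MS then ⌊t / δ⌋₊ + 1 else 0

/-- The duration of the first `n` steps. -/
def durSum (M : MarkovAutomaton S Act) (ω : ℕ → Step S Act) (n : ℕ) : ℝ :=
  ∑ i ∈ Finset.range n, M.dur ω i

/-- The number of digitization steps among the first `n` steps. -/
def stepCount (M : MarkovAutomaton S Act) (δ : ℝ) (ω : ℕ → Step S Act) (n : ℕ) : ℕ :=
  ∑ i ∈ Finset.range n, M.stepCost δ (pathState M.init ω i) (M.dur ω i)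

open Classical in
/-- The number of digitization steps among those of the first `n` steps that are completed by
time `b`. -/
def stepCountUntil (M : MarkovAutomaton S Act) (δ b : ℝ) (ω : ℕ → Step S Act) (n : ℕ) : ℕ :=
  ∑ i ∈ Finset.range n, if M.durSum ω (i + 1) ≤ b then
    M.stepCost δ (pathState M.init ω i) (M.dur ω i) else 0

theorem durSum_succ (M : MarkovAutomaton S Act) (ω : ℕ → Step S Act) (n : ℕ) :
    M.durSum ω (n + 1) = M.durSum ω n + M.dur ω n := Finset.sum_range_succ _ _

theorem stepCount_succ (M : MarkovAutomaton S Act) (δ : ℝ) (ω : ℕ → Step S Act) (n : ℕ) :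
    M.stepCount δ ω (n + 1) =
      M.stepCount δ ω n + M.stepCost δ (pathState M.init ω n) (M.dur ω n) :=
  Finset.sum_range_succ _ _

theorem stepCount_mono (M : MarkovAutomaton S Act) (δ : ℝ) (ω : ℕ → Step S Act) :
    Monotone (M.stepCount δ ω) :=
  monotone_nat_of_le_succ fun n => by rw [stepCount_succ]; exact Nat.le_add_right _ _

theorem durSum_mono (M : MarkovAutomaton S Act) (ω : ℕ → Step S Act) :
    Monotone (M.durSum ω) :=
  monotone_nat_of_le_succ fun n => by
    rw [durSum_succ]; exact le_add_of_nonneg_right (M.dur_nonneg ω n)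

theorem stepCountUntil_mono (M : MarkovAutomaton S Act) (δ b : ℝ) (ω : ℕ → Step S Act) :
    Monotone (M.stepCountUntil δ b ω) :=
  monotone_nat_of_le_succ fun _ => by
    rw [stepCountUntil, stepCountUntil, Finset.sum_range_succ]
    exact Nat.le_add_right _ _

/-- The truncated count agrees with the true one up to time `b` and is frozen afterwards. Freezing
keeps a stay that crosses the deadline from being charged as an overrun. -/
theorem stepCountUntil_eq (M : MarkovAutomaton S Act) (δ : ℝ) {b : ℝ} {ω : ℕ → Step S Act} {n : ℕ}
    (h : M.durSum ω n ≤ b) : M.stepCountUntil δ b ω n = M.stepCount δ ω n :=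
  Finset.sum_congr rfl fun _ hi =>
    if_pos ((M.durSum_mono ω (Nat.succ_le_of_lt (Finset.mem_range.1 hi))).trans h)

theorem dur_eq_zero (M : MarkovAutomaton S Act) {ω : ℕ → Step S Act} {n : ℕ}
    (h : pathState M.init ω n ∉ M.MS) : M.dur ω n = 0 := if_neg h

theorem dur_le_stepCost (M : MarkovAutomaton S Act) {δ : ℝ} (hδ : 0 < δ) (ω : ℕ → Step S Act)
    (n : ℕ) : M.dur ω n ≤ M.stepCost δ (pathState M.init ω n) (M.dur ω n) * δ := by
  by_cases h : pathState M.init ω n ∈ M.MS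
  · rw [stepCost, if_pos h]
    push_cast
    exact ((div_lt_iff₀ hδ).1 (Nat.lt_floor_add_one _)).le
  · simp [dur_eq_zero M h, stepCost, h]

theorem durSum_le_stepCount (M : MarkovAutomaton S Act) {δ : ℝ} (hδ : 0 < δ)
    (ω : ℕ → Step S Act) (n : ℕ) : M.durSum ω n ≤ M.stepCount δ ω n * δ := by
  rw [durSum, stepCount, Nat.cast_sum, Finset.sum_mul]
  exact Finset.sum_le_sum fun _ _ => M.dur_le_stepCost hδ ω _

theorem dependsOn_dur (M : MarkovAutomaton S Act) {n N : ℕ} (h : n < N) :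
    DependsOn (fun ω => M.dur ω n) (Set.Iio N) := by
  intro x y hxy
  have h1 : pathState M.init x n = pathState M.init y n :=
    dependsOn_pathState M.init n fun _ hi => hxy _ (lt_trans hi h)
  simp only [dur]
  rw [h1, hxy n h]

theorem dependsOn_durSum (M : MarkovAutomaton S Act) (n : ℕ) :
    DependsOn (fun ω => M.durSum ω n) (Set.Iio n) := fun _ _ hxy =>
  Finset.sum_congr rfl fun _ hi => M.dependsOn_dur (Finset.mem_range.1 hi) hxy

theorem dependsOn_stepCost (M : MarkovAutomaton S Act) (δ : ℝ) {n N : ℕ} (h : n < N) :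
    DependsOn (fun ω => M.stepCost δ (pathState M.init ω n) (M.dur ω n)) (Set.Iio N) := by
  intro x y hxy
  have h1 : pathState M.init x n = pathState M.init y n :=
    dependsOn_pathState M.init n fun _ hi => hxy _ (lt_trans hi h)
  have h2 : M.dur x n = M.dur y n := M.dependsOn_dur h hxy
  simp only [h1, h2]

theorem dependsOn_stepCount (M : MarkovAutomaton S Act) (δ : ℝ) (n : ℕ) :
    DependsOn (fun ω => M.stepCount δ ω n) (Set.Iio n) := fun _ _ hxy =>
  Finset.sum_congr rfl fun _ hi => M.dependsOn_stepCost δ (Finset.mem_range.1 hi) hxy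

theorem dependsOn_stepCountUntil (M : MarkovAutomaton S Act) (δ b : ℝ) (n : ℕ) :
    DependsOn (fun ω => M.stepCountUntil δ b ω n) (Set.Iio n) := fun x y hxy =>
  Finset.sum_congr rfl fun i hi => by
    have hi' := Finset.mem_range.1 hi
    have h1 : M.durSum x (i + 1) = M.durSum y (i + 1) :=
      M.dependsOn_durSum (i + 1) fun l hl =>
        hxy l (Set.mem_Iio.2 ((Set.mem_Iio.1 hl).trans_le hi'))
    have h2 := M.dependsOn_stepCost δ hi' hxy
    simp only at h2
    rw [h1, h2]

theorem exitRate_le_maxRate [Finite S] (M : MarkovAutomaton S Act) {s : S} (hs : s ∈ M.MS) :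
    M.exitRate s ≤ M.maxRate :=
  le_csSup (Set.toFinite _).bddAbove (Set.mem_image_of_mem _ hs)

theorem maxRate_nonneg (M : MarkovAutomaton S Act) : 0 ≤ M.maxRate :=
  Real.sSup_nonneg fun _ ⟨_, hs, h⟩ => h ▸ (M.exitRate_pos hs).le

/-- The submartingale inequality for one stay. An overrun has value 0, passing the deadline is
absorbing with value 1, and a probabilistic state changes neither time nor count; only a Markovian
stay before the deadline needs analysis. -/
theorem budgetValue_le_lintegral (M : MarkovAutomaton S Act) {lam δ : ℝ} (hδ : 0 < δ) {s : S}
    (hle : s ∈ M.MS → M.exitRate s ≤ lam) (k : ℕ) {T : ℝ} {c : ℕ}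
    (hT : T ≤ k * δ → T ≤ c * δ) :
    budgetValue lam δ k T c ≤ ∫⁻ t, budgetValue lam δ k (T + t)
      (c + if T + t ≤ k * δ then M.stepCost δ s t else 0) ∂M.durLaw s := by
  have hp := M.isProbabilityMeasure_durLaw s
  have hcost : Measurable (M.stepCost δ s) := by
    unfold stepCost
    split_ifs
    · exact (Nat.measurable_floor.comp (by fun_prop)).add_const 1
    · exact measurable_const
  have hmeas : Measurable fun t => budgetValue lam δ k (T + t)
      (c + if T + t ≤ k * δ then M.stepCost δ s t else 0) :=
    (measurable_budgetValue lam δ k).comp ((measurable_const.add measurable_id).prodMk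
      (measurable_const.add (Measurable.ite (measurableSet_le (by fun_prop) measurable_const)
        hcost measurable_const)))
  by_cases hc : k < c
  · simp [budgetValue, hc]
  by_cases hkT : k * δ < T
  · rw [budgetValue, if_neg hc, if_pos hkT]
    calc (1 : ENNReal) = ∫⁻ _, 1 ∂M.durLaw s := by simp
      _ ≤ _ := by
        refine lintegral_mono_ae ((M.ae_durLaw_nonneg s).mono fun t ht => ?_)
        have h1 : ¬ T + t ≤ k * δ := by linarith
        simp [budgetValue, h1, hc, not_le.1 h1]
  by_cases hs : s ∈ M.MS
  · have hE := M.exitRate_pos hs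
    rw [budgetValue, if_neg hc, if_neg hkT, durLaw, if_pos hs, lintegral_map hmeas (by fun_prop)]
    -- Remaining time u = kδ - T and remaining steps j = k - c; the requirement jδ ≤ u is T ≤ cδ.
    refine le_lintegral_expMeasure hE (hle hs) hδ ?_ (hmeas.comp (by fun_prop)) ?_ ?_
    · rw [Nat.cast_sub (not_lt.1 hc)]
      have := hT (not_lt.1 hkT)
      linarith
    · intro t ht
      have ht0 : 0 ≤ t := by linarith
      have h1 : ¬ T + t ≤ k * δ := by linarith
      simp [budgetValue, h1, hc, not_le.1 h1, max_eq_left ht0]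
    · intro t ht0 ht hj
      have h1 : T + t ≤ k * δ := by linarith
      have h2 : ¬ k < c + (⌊t / δ⌋₊ + 1) := by omega
      simp only [max_eq_left ht0, h1, if_true, stepCost, hs, budgetValue, h2, if_false,
        not_lt.2 h1]
      rw [Nat.sub_sub, sub_sub]
  · rw [durLaw, if_neg hs, lintegral_dirac' _ hmeas]
    simp [stepCost, hs]

theorem measurable_stepCost [MeasurableSpace S]
    [DiscreteMeasurableSpace S] (M : MarkovAutomaton S Act) (δ : ℝ) :
    Measurable fun p : S × ℝ => M.stepCost δ p.1 p.2 := by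
  refine Measurable.ite (measurable_fst (MeasurableSet.of_discrete (s := M.MS))) ?_
    measurable_const
  exact (Nat.measurable_floor.comp (by fun_prop)).add_const 1

variable [Fintype S] [Fintype Act]
  [MeasurableSpace S] [DiscreteMeasurableSpace S] [MeasurableSpace Act]

theorem measurable_durSum (M : MarkovAutomaton S Act) (n : ℕ) :
    Measurable fun ω : ℕ → Step S Act => M.durSum ω n :=
  Finset.measurable_sum _ fun i _ => M.measurable_dur i

theorem measurable_stepCost_path (M : MarkovAutomaton S Act) (δ : ℝ) (n : ℕ) :
    Measurable fun ω : ℕ → Step S Act => M.stepCost δ (pathState M.init ω n) (M.dur ω n) :=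
  (M.measurable_stepCost δ).comp ((M.measurable_pathState n).prodMk (M.measurable_dur n))

theorem measurable_stepCount (M : MarkovAutomaton S Act) (δ : ℝ) (n : ℕ) :
    Measurable fun ω : ℕ → Step S Act => M.stepCount δ ω n :=
  Finset.measurable_sum _ fun i _ => M.measurable_stepCost_path δ i

theorem measurable_stepCountUntil (M : MarkovAutomaton S Act) (δ b : ℝ) (n : ℕ) :
    Measurable fun ω : ℕ → Step S Act => M.stepCountUntil δ b ω n :=
  Finset.measurable_sum _ fun i _ =>
    Measurable.ite (measurableSet_le (M.measurable_durSum _) measurable_const)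
      (M.measurable_stepCost_path δ i) measurable_const

/-! ### Probabilities of the two bad events -/

/-- The value is a submartingale: it is at most its expectation after `n` steps. -/
theorem budgetValue_le_lintegral_pathMeasure (M : MarkovAutomaton S Act) (σ : M.Scheduler) {δ : ℝ}
    (hδ : 0 < δ) (k n : ℕ) : budgetValue M.maxRate δ k 0 0 ≤
      ∫⁻ ω, budgetValue M.maxRate δ k (M.durSum ω n) (M.stepCountUntil δ (k * δ) ω n)
        ∂M.pathMeasure σ := by
  classical
  induction n with
  | zero => simp [durSum, stepCountUntil]
  | succ n ih =>
    refine ih.trans ?_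
    have hA : Measurable fun ω : ℕ → Step S Act =>
        (pathState M.init ω n, M.durSum ω n, M.stepCountUntil δ (k * δ) ω n) :=
      (M.measurable_pathState n).prodMk
        ((M.measurable_durSum n).prodMk (M.measurable_stepCountUntil δ _ n))
    have hdep : DependsOn (fun ω : ℕ → Step S Act =>
        (pathState M.init ω n, M.durSum ω n, M.stepCountUntil δ (k * δ) ω n)) (Set.Iio n) :=
      fun x y hxy => Prod.ext (dependsOn_pathState M.init n hxy)
        (Prod.ext (M.dependsOn_durSum n hxy) (M.dependsOn_stepCountUntil δ _ n hxy))
    have hf : Measurable (Function.uncurry fun (p : S × ℝ × ℕ) (t : ℝ) =>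
        budgetValue M.maxRate δ k (p.2.1 + t)
          (p.2.2 + if p.2.1 + t ≤ k * δ then M.stepCost δ p.1 t else 0)) := by
      refine (measurable_budgetValue M.maxRate δ k).comp (Measurable.prodMk (by fun_prop)
        (Measurable.add (by fun_prop) (Measurable.ite
          (measurableSet_le (by fun_prop) measurable_const) ?_ measurable_const)))
      exact (M.measurable_stepCost δ).comp
        ((measurable_fst.comp measurable_fst).prodMk measurable_snd)
    have e : ∀ ω : ℕ → Step S Act, M.stepCountUntil δ (k * δ) ω (n + 1) =
        M.stepCountUntil δ (k * δ) ω n + if M.durSum ω n + M.dur ω n ≤ k * δ then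
          M.stepCost δ (pathState M.init ω n) (M.dur ω n) else 0 := fun ω => by
      rw [stepCountUntil, Finset.sum_range_succ, durSum_succ]
      rfl
    simp only [e, durSum_succ]
    rw [M.lintegral_dur σ n hA hdep hf]
    refine lintegral_mono fun ω => ?_
    refine M.budgetValue_le_lintegral hδ (fun hs => M.exitRate_le_maxRate hs) k fun h => ?_
    rw [stepCountUntil_eq M δ h]
    exact M.durSum_le_stepCount hδ ω n

/-- The probability to complete more than `k` digitization steps within time `k δ`. -/
theorem measure_stepCount_gt_le (M : MarkovAutomaton S Act) (σ : M.Scheduler) {δ : ℝ}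
    (hδ : 0 < δ) (k : ℕ) :
    (M.pathMeasure σ).real {ω | ∃ n, M.durSum ω n ≤ k * δ ∧ k < M.stepCount δ ω n} ≤
      1 - (1 + M.maxRate * δ) ^ k * Real.exp (-(M.maxRate * k * δ)) := by
  have hlam := M.maxRate_nonneg
  set v := (1 + M.maxRate * δ) ^ k * Real.exp (-(M.maxRate * k * δ)) with hv
  have hv0 : 0 ≤ v := by positivity
  have hval : budgetValue M.maxRate δ k 0 0 = ENNReal.ofReal v := by
    have : ¬ (k : ℝ) * δ < 0 := not_lt.2 (by positivity)
    rw [budgetValue, if_neg (Nat.not_lt_zero k), if_neg this, hv, sub_zero, Nat.sub_zero,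
      mul_comm, mul_assoc]
  -- The truncated count makes these events increase with `n`, so a bound uniform in `n` passes to
  -- their union.
  set F : ℕ → Set (ℕ → Step S Act) := fun n => {ω | k < M.stepCountUntil δ (k * δ) ω n} with hF
  have hFm : ∀ n, MeasurableSet (F n) := fun n =>
    measurableSet_lt measurable_const (M.measurable_stepCountUntil δ _ n)
  have hFb : ∀ n, (M.pathMeasure σ) (F n) ≤ ENNReal.ofReal (1 - v) := by
    intro n
    have h1 : ENNReal.ofReal v ≤ (M.pathMeasure σ) (F n)ᶜ := by
      rw [← hval, ← lintegral_indicator_one (hFm n).compl]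
      refine (M.budgetValue_le_lintegral_pathMeasure σ hδ k n).trans (lintegral_mono fun ω => ?_)
      by_cases h : ω ∈ F n
      · have h' : k < M.stepCountUntil δ (k * δ) ω n := h
        simp [budgetValue, h']
      · rw [Set.indicator_of_mem (show ω ∈ (F n)ᶜ from h)]
        refine budgetValue_le_one hlam hδ fun h => ?_
        rw [stepCountUntil_eq M δ h]
        exact M.durSum_le_stepCount hδ ω n
    rw [prob_compl_eq_one_sub (hFm n)] at h1
    rw [ENNReal.ofReal_sub _ hv0, ENNReal.ofReal_one]
    exact ENNReal.le_sub_of_add_le_left ENNReal.ofReal_ne_top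
      ((add_le_add_left h1 _).trans_eq (tsub_add_cancel_of_le prob_le_one))
  have hmono : Monotone F := fun m n hmn ω (h : k < _) =>
    lt_of_lt_of_le h (M.stepCountUntil_mono δ _ ω hmn)
  have hU : (M.pathMeasure σ) (⋃ n, F n) ≤ ENNReal.ofReal (1 - v) := by
    rw [hmono.measure_iUnion]
    exact iSup_le hFb
  have hsub : {ω | ∃ n, M.durSum ω n ≤ k * δ ∧ k < M.stepCount δ ω n} ⊆ ⋃ n, F n := by
    rintro ω ⟨n, h1, h2⟩
    refine Set.mem_iUnion.2 ⟨n, ?_⟩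
    show k < _
    rwa [stepCountUntil_eq M δ h1]
  have hv1 : v ≤ 1 := by
    have h0 : budgetValue M.maxRate δ k 0 0 ≤ 1 := budgetValue_le_one hlam hδ (by simp)
    rwa [hval, ENNReal.ofReal_le_one] at h0
  exact ENNReal.toReal_le_of_le_ofReal (sub_nonneg.2 hv1) ((measure_mono hsub).trans hU)

/-- The probability that the digitization step number `j + 1` leaves a Markovian state. -/
theorem measure_stepCount_eq_le (M : MarkovAutomaton S Act) (σ : M.Scheduler) {δ : ℝ}
    (hδ : 0 < δ) (j : ℕ) :
    (M.pathMeasure σ).real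
        {ω | ∃ n, M.stepCount δ ω n ≤ j ∧ M.stepCount δ ω (n + 1) = j + 1} ≤
      1 - Real.exp (-M.maxRate * δ) := by
  classical
  have hlam := M.maxRate_nonneg
  have hp0 : 0 ≤ 1 - Real.exp (-M.maxRate * δ) :=
    sub_nonneg.2 (Real.exp_le_one_iff.2 (by nlinarith))
  -- `B n`: step j + 1 belongs to stay `n`. `J n`: it is moreover the last step of that stay.
  set B : ℕ → Set (ℕ → Step S Act) := fun n =>
    {ω | M.stepCount δ ω n ≤ j ∧ j < M.stepCount δ ω (n + 1)} with hB
  set J : ℕ → Set (ℕ → Step S Act) := fun n =>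
    {ω | M.stepCount δ ω n ≤ j ∧ M.stepCount δ ω (n + 1) = j + 1} with hJ
  have hBm : ∀ n, MeasurableSet (B n) := fun n =>
    (measurableSet_le (M.measurable_stepCount δ n) measurable_const).inter
      (measurableSet_lt measurable_const (M.measurable_stepCount δ (n + 1)))
  have hJm : ∀ n, MeasurableSet (J n) := fun n =>
    (measurableSet_le (M.measurable_stepCount δ n) measurable_const).inter
      (measurableSet_eq_fun (M.measurable_stepCount δ (n + 1)) measurable_const)
  have hdisj : Pairwise (Function.onFun Disjoint B) := by
    have : ∀ m n, m < n → Disjoint (B m) (B n) := fun m n hmn =>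
      Set.disjoint_left.2 fun ω hm hn => absurd
        (hm.2.trans_le (M.stepCount_mono δ ω (Nat.succ_le_of_lt hmn))) (not_lt.2 hn.1)
    intro m n hmn
    rcases lt_or_gt_of_ne hmn with h | h
    exacts [this m n h, (this n m h).symm]
  -- The predicate `R` on the new count lets one conditioning argument serve both `J n` and `B n`.
  have hgen : ∀ (R : ℕ → Prop) (n : ℕ), MeasurableSet
      {ω : ℕ → Step S Act | M.stepCount δ ω n ≤ j ∧ R (M.stepCount δ ω (n + 1))} →
      (M.pathMeasure σ) {ω | M.stepCount δ ω n ≤ j ∧ R (M.stepCount δ ω (n + 1))} =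
      ∫⁻ ω, M.durLaw (pathState M.init ω n) {t | M.stepCount δ ω n ≤ j ∧
        R (M.stepCount δ ω n + M.stepCost δ (pathState M.init ω n) t)} ∂M.pathMeasure σ := by
    intro R n hR
    have hf0 : MeasurableSet {p : (S × ℕ) × ℝ | p.1.2 ≤ j ∧
        R (p.1.2 + M.stepCost δ p.1.1 p.2)} := by
      have hc : Measurable fun p : (S × ℕ) × ℝ => M.stepCost δ p.1.1 p.2 :=
        (M.measurable_stepCost δ).comp
          ((measurable_fst.comp measurable_fst).prodMk measurable_snd)
      refine (measurableSet_le (measurable_snd.comp measurable_fst) measurable_const).inter ?_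
      have hadd : Measurable fun p : (S × ℕ) × ℝ => p.1.2 + M.stepCost δ p.1.1 p.2 :=
        (measurable_snd.comp measurable_fst).add hc
      exact hadd (MeasurableSet.of_discrete (s := {m | R m}))
    have hf : Measurable (Function.uncurry fun (p : S × ℕ) (t : ℝ) =>
        ({t | p.2 ≤ j ∧ R (p.2 + M.stepCost δ p.1 t)} : Set ℝ).indicator
          (fun _ => (1 : ENNReal)) t) := (measurable_const (a := (1 : ENNReal))).indicator hf0
    have e := M.lintegral_dur σ n (A := fun ω => (pathState M.init ω n, M.stepCount δ ω n))
      ((M.measurable_pathState n).prodMk (M.measurable_stepCount δ n))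
      (fun x y hxy => Prod.ext (dependsOn_pathState M.init n hxy) (M.dependsOn_stepCount δ n hxy))
      hf
    rw [← lintegral_indicator_one hR]
    refine Eq.trans ?_ (e.trans (lintegral_congr fun ω => ?_))
    · refine lintegral_congr fun ω => ?_
      simp only [Set.indicator, stepCount_succ, Set.mem_ofPred_eq, Pi.one_apply]
    · exact lintegral_indicator_one
        (hf0.preimage (measurable_prodMk_left (x := (pathState M.init ω n, M.stepCount δ ω n))))
  have hJB : ∀ n, (M.pathMeasure σ) (J n) ≤
      ENNReal.ofReal (1 - Real.exp (-M.maxRate * δ)) * (M.pathMeasure σ) (B n) := by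
    intro n
    rw [hgen (fun m => m = j + 1) n (hJm n), hgen (fun m => j < m) n (hBm n),
      ← lintegral_const_mul' _ _ ENNReal.ofReal_ne_top]
    refine lintegral_mono fun ω => ?_
    by_cases hc : M.stepCount δ ω n ≤ j
    · by_cases hs : pathState M.init ω n ∈ M.MS
      · have := M.durLaw_floor_eq_le hs hδ (M.exitRate_le_maxRate hs) (j - M.stepCount δ ω n)
        convert this using 3
        · ext t
          simp only [stepCost, hs, if_true]
          omega
        · congr 1
          ext t
          simp only [stepCost, hs, if_true]
          omega
      · have : ({t | M.stepCount δ ω n ≤ j ∧ M.stepCount δ ω n +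
            M.stepCost δ (pathState M.init ω n) t = j + 1} : Set ℝ) = ∅ := by
          refine Set.eq_empty_iff_forall_notMem.2 fun t ⟨_, ht⟩ => ?_
          rw [stepCost, if_neg hs] at ht
          omega
        rw [this]
        simp
    · simp [hc]
  have hU : (M.pathMeasure σ) (⋃ n, J n) ≤ ENNReal.ofReal (1 - Real.exp (-M.maxRate * δ)) := by
    calc (M.pathMeasure σ) (⋃ n, J n) ≤ ∑' n, (M.pathMeasure σ) (J n) := measure_iUnion_le _
      _ ≤ ∑' n, ENNReal.ofReal (1 - Real.exp (-M.maxRate * δ)) * (M.pathMeasure σ) (B n) :=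
        ENNReal.tsum_le_tsum hJB
      _ = ENNReal.ofReal (1 - Real.exp (-M.maxRate * δ)) * (M.pathMeasure σ) (⋃ n, B n) := by
        rw [ENNReal.tsum_mul_left, measure_iUnion hdisj hBm]
      _ ≤ _ := mul_le_of_le_one_right' prob_le_one
  refine ENNReal.toReal_le_of_le_ofReal hp0 (le_trans (measure_mono ?_) hU)
  rintro ω ⟨n, h⟩
  exact Set.mem_iUnion.2 ⟨n, h⟩

end MarkovAutomaton

/-! ### Combinatorics of the digitized path -/

namespace MarkovAutomaton

variable {S Act : Type*}

theorem offset_succ (δ : ℝ) (ω : ℕ → Step S Act) (i : ℕ) :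
    offset δ ω (i + 1) = offset δ ω i + (waitSteps δ ω i + 1) := Finset.sum_range_succ _ _

theorem strictMono_offset (δ : ℝ) (ω : ℕ → Step S Act) : StrictMono (offset δ ω) :=
  strictMono_nat_of_lt_succ fun i => by rw [offset_succ]; omega

theorem offset_blockIndex_le (δ : ℝ) (ω : ℕ → Step S Act) (p : ℕ) :
    offset δ ω (blockIndex δ ω p) ≤ p := by
  unfold blockIndex
  exact Nat.findGreatest_spec (P := fun i => offset δ ω i ≤ p) (Nat.zero_le p) (by simp [offset])

theorem lt_offset_blockIndex_succ (δ : ℝ) (ω : ℕ → Step S Act) (p : ℕ) :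
    p < offset δ ω (blockIndex δ ω p + 1) := by
  by_contra h
  have h1 := not_lt.1 h
  have h2 := ((strictMono_offset δ ω).id_le _).trans h1
  have := Nat.le_findGreatest (P := fun i => offset δ ω i ≤ p) h2 h1
  exact absurd this (Nat.not_succ_le_self _)

theorem blockIndex_eq {δ : ℝ} {ω : ℕ → Step S Act} {p i : ℕ} (h1 : offset δ ω i ≤ p)
    (h2 : p < offset δ ω (i + 1)) : blockIndex δ ω p = i := by
  have h3 := (strictMono_offset δ ω).lt_iff_lt.1 (h1.trans_lt (lt_offset_blockIndex_succ δ ω p))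
  have h4 := (strictMono_offset δ ω).lt_iff_lt.1 ((offset_blockIndex_le δ ω p).trans_lt h2)
  omega

/-- All positions of a block show the same state, since only the last step of the block moves on. -/
theorem pathState_digitizePath (M : MarkovAutomaton S Act) (δ : ℝ) (ω : ℕ → Step S Act) (p : ℕ) :
    pathState M.init (M.digitizePath δ ω) p = pathState M.init ω (blockIndex δ ω p) := by
  cases p with
  | zero => simp [blockIndex, pathState]
  | succ p =>
    have h1 := offset_blockIndex_le δ ω p
    have h2 := lt_offset_blockIndex_succ δ ω p
    simp only [pathState, digitizePath]
    split_ifs with h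
    · rw [blockIndex_eq (h1.trans (Nat.le_succ p)) h]
    · have h3 : offset δ ω (blockIndex δ ω p + 1) = p + 1 := by omega
      rw [blockIndex_eq (i := blockIndex δ ω p + 1) h3.le]
      rw [← h3]
      exact strictMono_offset δ ω (Nat.lt_succ_self _)

open Classical in
theorem dsCount_succ (M : MarkovAutomaton S Act) (ω : ℕ → Act × S) (n : ℕ) :
    M.dsCount ω (n + 1) = M.dsCount ω n + if pathState M.init ω n ∈ M.MS then 1 else 0 := by
  unfold dsCount
  rw [Finset.range_add_one, Finset.filter_insert]
  split_ifs
  · rw [Finset.card_insert_of_notMem (by simp)]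
  · rfl

open Classical in
theorem dsCount_offset_add' (M : MarkovAutomaton S Act) (δ : ℝ) (ω : ℕ → Step S Act) (i r : ℕ)
    (hr : r ≤ waitSteps δ ω i + 1) : M.dsCount (M.digitizePath δ ω) (offset δ ω i + r) =
      M.dsCount (M.digitizePath δ ω) (offset δ ω i) +
        if pathState M.init ω i ∈ M.MS then r else 0 := by
  induction r with
  | zero => simp
  | succ r ih =>
    rw [← add_assoc, dsCount_succ, ih (by omega), pathState_digitizePath,
      blockIndex_eq (Nat.le_add_right _ _) (by rw [offset_succ]; omega)]
    split_ifs <;> rfl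

theorem dsCount_offset (M : MarkovAutomaton S Act) (δ : ℝ) (ω : ℕ → Step S Act) (i : ℕ) :
    M.dsCount (M.digitizePath δ ω) (offset δ ω i) = M.stepCount δ ω i := by
  classical
  induction i with
  | zero => simp [offset, stepCount, dsCount]
  | succ i ih =>
    rw [offset_succ, dsCount_offset_add' M δ ω i _ le_rfl, ih, stepCount_succ]
    unfold stepCost dur waitSteps
    split_ifs <;> rfl

open Classical in
theorem dsCount_offset_add (M : MarkovAutomaton S Act) (δ : ℝ) (ω : ℕ → Step S Act) {i r : ℕ}
    (hr : r ≤ waitSteps δ ω i + 1) : M.dsCount (M.digitizePath δ ω) (offset δ ω i + r) =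
      M.stepCount δ ω i + if pathState M.init ω i ∈ M.MS then r else 0 := by
  rw [dsCount_offset_add' M δ ω i r hr, dsCount_offset]

open Classical in
/-- Reachability in the digitization of a path, in terms of the path itself. -/
theorem exists_dsCount_mem_iff (M : MarkovAutomaton S Act) (δ : ℝ) (ω : ℕ → Step S Act)
    (J : Set ℕ) (G : Set S) :
    (∃ p, pathState M.init (M.digitizePath δ ω) p ∈ G ∧ M.dsCount (M.digitizePath δ ω) p ∈ J) ↔
      ∃ i r, r ≤ waitSteps δ ω i ∧ pathState M.init ω i ∈ G ∧
        (M.stepCount δ ω i + if pathState M.init ω i ∈ M.MS then r else 0) ∈ J := by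
  constructor
  · rintro ⟨p, h1, h2⟩
    have h3 := offset_blockIndex_le δ ω p
    have h4 := lt_offset_blockIndex_succ δ ω p
    rw [offset_succ] at h4
    rw [pathState_digitizePath] at h1
    obtain ⟨r, hr⟩ := Nat.exists_eq_add_of_le h3
    refine ⟨blockIndex δ ω p, r, by omega, h1, ?_⟩
    rw [← dsCount_offset_add M δ ω (by omega), ← hr]
    exact h2
  · rintro ⟨i, r, hr, h1, h2⟩
    refine ⟨offset δ ω i + r, ?_, ?_⟩
    · rw [pathState_digitizePath,
        blockIndex_eq (Nat.le_add_right _ _) (by rw [offset_succ]; omega)]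
      exact h1
    · rwa [dsCount_offset_add M δ ω (by omega)]

theorem mem_PS_of_not_mem_MS (M : MarkovAutomaton S Act) {s : S} (hs : s ∉ M.MS) : s ∈ M.PS :=
  (M.prob_or_markovian s).resolve_right hs

theorem time_eq_zero {M : MarkovAutomaton S Act} {ω : ℕ → Step S Act} (hω : ω ∈ M.infPaths)
    {i : ℕ} (hi : pathState M.init ω i ∉ M.MS) : (ω i).1.time = 0 := by
  obtain ⟨a, ha⟩ := (hω.2 i).2.1 (M.mem_PS_of_not_mem_MS hi)
  rw [ha]
  rfl

theorem dur_eq_time {M : MarkovAutomaton S Act} {ω : ℕ → Step S Act} (hω : ω ∈ M.infPaths)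
    (i : ℕ) : M.dur ω i = (ω i).1.time := by
  unfold dur
  split_ifs with h
  exacts [rfl, (time_eq_zero hω h).symm]

theorem durSum_eq_elapsed {M : MarkovAutomaton S Act} {ω : ℕ → Step S Act} (hω : ω ∈ M.infPaths)
    (n : ℕ) : M.durSum ω n = elapsed ω n :=
  Finset.sum_congr rfl fun i _ => dur_eq_time hω i

theorem digitization_prob_pos [Fintype S] (M : MarkovAutomaton S Act) {δ : ℝ} (hδ : 0 < δ)
    {s s' : S} (hs : s ∈ M.MS) (h : s' = s ∨ 0 < M.prob s M.tau s') :
    0 < (M.digitization hδ).prob s M.tau s' := by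
  have hE := M.exitRate_pos hs
  have he := Real.exp_pos (-M.exitRate s * δ)
  have he1 : Real.exp (-M.exitRate s * δ) < 1 := Real.exp_lt_one_iff.2 (by nlinarith)
  have hP := mul_nonneg (M.prob_mem s M.tau s').1 (sub_pos.2 he1).le
  simp only [digitization, hs, and_self, if_true]
  split_ifs with h'
  · linarith
  · exact mul_pos (h.resolve_left (Ne.symm h')) (sub_pos.2 he1)

/-- In a Markovian state both the self-loop and every original transition keep positive probability.
A probabilistic state has sojourn time 0, hence a block of length one and no added self-loop. -/
theorem digitizePath_mem_infPaths [Fintype S] {M : MarkovAutomaton S Act} {δ : ℝ} (hδ : 0 < δ)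
    {ω : ℕ → Step S Act} (hω : ω ∈ M.infPaths) :
    M.digitizePath δ ω ∈ (M.digitization hδ).infPaths := by
  intro p
  have hinit : (M.digitization hδ).init = M.init := rfl
  have hstep : pathState M.init (M.digitizePath δ ω) (p + 1) = (M.digitizePath δ ω p).2 := rfl
  rw [hinit, hstep, pathState_digitizePath]
  simp only [digitizePath]
  obtain ⟨h1, -, h2⟩ := hω.2 (blockIndex δ ω p)
  by_cases hs : pathState M.init ω (blockIndex δ ω p) ∈ M.MS
  · obtain ⟨t, ht⟩ := h2 hs
    rw [ht] at h1 ⊢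
    refine M.digitization_prob_pos hδ hs ?_
    split_ifs
    exacts [Or.inl rfl, Or.inr h1]
  · have h3 : ¬ p + 1 < offset δ ω (blockIndex δ ω p + 1) := by
      have h4 := offset_blockIndex_le δ ω p
      rw [offset_succ, waitSteps, time_eq_zero hω hs]
      simp only [zero_div, Nat.floor_zero]
      omega
    simp only [digitization, hs, h3, if_false, false_and]
    exact h1

open Classical in
theorem mem_inducedPaths_dsReach_iff [Fintype S] {M : MarkovAutomaton S Act} {δ : ℝ} (hδ : 0 < δ)
    {ω : ℕ → Step S Act} (hω : ω ∈ M.infPaths) (J : Set ℕ) (G : Set S) :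
    ω ∈ M.inducedPaths δ (M.dsReach hδ J G) ↔
      ∃ i r, r ≤ waitSteps δ ω i ∧ pathState M.init ω i ∈ G ∧
        (M.stepCount δ ω i + if pathState M.init ω i ∈ M.MS then r else 0) ∈ J := by
  rw [← exists_dsCount_mem_iff]
  exact ⟨fun h => h.2.2, fun h => ⟨hω, digitizePath_mem_infPaths hδ hω, h⟩⟩

theorem manySteps_subset (M : MarkovAutomaton S Act) (δ : ℝ) {t : ℝ} (ht : 0 ≤ t) (k : ℕ) :
    M.manySteps δ t k ⊆ {ω | ∃ n, M.durSum ω n ≤ t ∧ k < M.stepCount δ ω n} := by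
  rintro ω ⟨hω, h⟩
  rw [dsCount_offset] at h
  refine ⟨lengthUpTo ω t, ?_, h⟩
  rw [durSum_eq_elapsed hω]
  have hne : {n | elapsed ω n ≤ t}.Nonempty := ⟨0, by simpa [elapsed] using ht⟩
  -- Divergence of time bounds the set of prefix lengths; an unbounded set would have the default
  -- supremum 0.
  refine Nat.sSup_mem hne ?_
  obtain ⟨N, hN⟩ := (hω.1.eventually_gt_atTop t).exists_forall_of_atTop
  exact ⟨N, fun n hn => le_of_not_ge fun h => absurd (hN n h) (not_lt.2 hn)⟩

/-- A Markovian stay is strictly shorter than its number of steps times δ. Strictness settles the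
end point: at most j completed steps, for j > 0, cannot reach time jδ. -/
theorem durSum_lt_stepCount (M : MarkovAutomaton S Act) {δ : ℝ} (hδ : 0 < δ)
    (ω : ℕ → Step S Act) {n : ℕ} (h0 : M.stepCount δ ω n ≠ 0) :
    M.durSum ω n < M.stepCount δ ω n * δ := by
  induction n with
  | zero => exact absurd rfl h0
  | succ n ih =>
    rw [durSum_succ, stepCount_succ]
    rw [stepCount_succ] at h0
    by_cases hs : pathState M.init ω n ∈ M.MS
    · have h1 := M.durSum_le_stepCount hδ ω n
      rw [stepCost, if_pos hs]
      push_cast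
      have := (div_lt_iff₀ hδ).1 (Nat.lt_floor_add_one (M.dur ω n / δ))
      nlinarith
    · simp only [stepCost, hs, if_false, add_zero, M.dur_eq_zero hs] at h0 ⊢
      exact ih h0

theorem stepCount_succ_of_mem {M : MarkovAutomaton S Act} {δ : ℝ} {ω : ℕ → Step S Act} {n : ℕ}
    (hs : pathState M.init ω n ∈ M.MS) :
    M.stepCount δ ω (n + 1) = M.stepCount δ ω n + (waitSteps δ ω n + 1) := by
  rw [stepCount_succ, stepCost, if_pos hs, dur, if_pos hs, waitSteps]

/-! ### Pathwise comparison of timed and digital reachability -/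

section Comparison

variable [Fintype S] {M : MarkovAutomaton S Act} {δ : ℝ} (hδ : 0 < δ) {I : TimeInterval} {j : ℕ}
  {U : Set ℝ} (hU : IsLowerSet U) (hI : ∀ x, x ∈ I.toSet ↔ j * δ ≤ x ∧ x ∈ U)
  (hJ : ∀ n, n ∈ I.digitize δ ↔ (j = 0 ∨ j < n) ∧ (n : ℝ) * δ ∈ U) (G : Set S)

include hU hI hJ

/-- The lower set `U` encodes the upper end of the interval, so bounded and unbounded intervals are
treated together. The upper end costs nothing here, because real time is never ahead of the digital
clock. -/
theorem inducedPaths_subset (hj : j * δ ∈ U) :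
    M.inducedPaths δ (M.dsReach hδ (I.digitize δ) G) ⊆ M.timedReach I G ∪
      {ω | j ≠ 0 ∧ ∃ n, M.durSum ω n ≤ j * δ ∧ j < M.stepCount δ ω n} := by
  classical
  intro ω h
  have hω := h.1
  obtain ⟨i, r, hr, hG, hc⟩ := (mem_inducedPaths_dsReach_iff hδ hω _ G).1 h
  obtain ⟨hc1, hc2⟩ := (hJ _).1 hc
  have hTi : M.durSum ω i ∈ U := by
    refine hU ?_ hc2
    refine (M.durSum_le_stepCount hδ ω i).trans (mul_le_mul_of_nonneg_right ?_ hδ.le)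
    exact_mod_cast Nat.le_add_right _ _
  -- If the stay lasts until time jδ, then max(jδ, T_i) is a common point with the interval.
  -- Otherwise more than j steps are completed before jδ.
  by_cases hT : j * δ ≤ M.durSum ω (i + 1)
  · left
    refine ⟨hω, i, hG, max (j * δ) (M.durSum ω i), (hI _).2 ⟨le_max_left _ _, ?_⟩, ?_, ?_⟩
    · rcases max_choice ((j : ℝ) * δ) (M.durSum ω i) with e | e <;> rw [e] <;> assumption
    · rw [← durSum_eq_elapsed hω]
      exact le_max_right _ _
    · rw [← durSum_eq_elapsed hω, ← dur_eq_time hω, ← durSum_succ]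
      exact max_le hT (M.durSum_mono ω (Nat.le_succ i))
  · right
    have hT' := not_le.1 hT
    have hj0 : j ≠ 0 := by
      rintro rfl
      have : 0 ≤ M.durSum ω (i + 1) := Finset.sum_nonneg fun l _ => M.dur_nonneg ω l
      simp only [Nat.cast_zero, zero_mul] at hT'
      linarith
    refine ⟨hj0, i + 1, hT'.le, (hc1.resolve_left hj0).trans_le ?_⟩
    split_ifs with hs
    · rw [stepCount_succ_of_mem hs]
      omega
    · exact M.stepCount_mono δ ω (Nat.le_succ i)

/-- Entering the state may already exceed the step bound, which is an overrun at the upper end.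
Otherwise the first admissible count is at hand on entry or is reached by self-loops, unless step j
+ 1 is the one that leaves. -/
theorem timedReach_subset (hj : (j + 1 : ℕ) * δ ∈ U) :
    M.timedReach I G ⊆ M.inducedPaths δ (M.dsReach hδ (I.digitize δ) G) ∪
      ({ω | ∃ n, M.durSum ω n ∈ U ∧ M.stepCount δ ω n * δ ∉ U} ∪
      {ω | j ≠ 0 ∧ ∃ n, M.stepCount δ ω n ≤ j ∧ M.stepCount δ ω (n + 1) = j + 1}) := by
  classical
  rintro ω ⟨hω, n, hG, x, hx, hx1, hx2⟩
  obtain ⟨hx3, hx4⟩ := (hI _).1 hx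
  rw [← durSum_eq_elapsed hω] at hx1 hx2
  rw [← dur_eq_time hω, ← durSum_succ] at hx2
  have hT := hU hx1 hx4
  by_cases hC : M.stepCount δ ω n * δ ∈ U
  swap
  · exact Or.inr (Or.inl ⟨n, hT, hC⟩)
  rw [Set.mem_union, mem_inducedPaths_dsReach_iff hδ hω]
  by_cases hjc : j = 0 ∨ j < M.stepCount δ ω n
  · exact Or.inl ⟨n, 0, Nat.zero_le _, hG, (hJ _).2 (by simpa using ⟨hjc, hC⟩)⟩
  obtain ⟨hj0, hjc⟩ := not_or.1 hjc
  have hjc := not_lt.1 hjc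
  have hjpos : 0 < (j : ℝ) * δ := mul_pos (Nat.cast_pos.2 (Nat.pos_of_ne_zero hj0)) hδ
  have hlt : j < M.stepCount δ ω (n + 1) := by
    by_contra hle
    have hle' : (M.stepCount δ ω (n + 1) : ℝ) * δ ≤ j * δ :=
      mul_le_mul_of_nonneg_right (Nat.cast_le.2 (not_lt.1 hle)) hδ.le
    by_cases h0 : M.stepCount δ ω (n + 1) = 0
    · have := M.durSum_le_stepCount hδ ω (n + 1)
      rw [h0] at this
      simp only [Nat.cast_zero, zero_mul] at this
      linarith
    · linarith [M.durSum_lt_stepCount hδ ω h0]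
  have hs : pathState M.init ω n ∈ M.MS := by
    by_contra hs
    rw [stepCount_succ, stepCost, if_neg hs] at hlt
    omega
  -- Step j + 1 lies in stay `n`. If it is a self-loop, the digital path is still in the state at
  -- count j + 1, which is admissible by `hj`.
  by_cases hw : j + 1 - M.stepCount δ ω n ≤ waitSteps δ ω n
  · refine Or.inl ⟨n, _, hw, hG, (hJ _).2 ?_⟩
    have e : M.stepCount δ ω n + (j + 1 - M.stepCount δ ω n) = j + 1 := by omega
    rw [if_pos hs, e]
    exact ⟨Or.inr (Nat.lt_succ_self j), hj⟩
  · refine Or.inr (Or.inr ⟨hj0, n, hjc, ?_⟩)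
    rw [stepCount_succ_of_mem hs] at hlt ⊢
    omega

end Comparison

end MarkovAutomaton

end

/-! ### The error bounds -/

theorem mainTheorem3 {S Act : Type*} [Fintype S] [Fintype Act]
    [MeasurableSpace S] [DiscreteMeasurableSpace S]
    [MeasurableSpace Act] [DiscreteMeasurableSpace Act]
    (M : MarkovAutomaton S Act) (hM : M.NonZeno) (σ : M.Scheduler)
    (δ : ℝ) (hδ : 0 < δ) :
    (∀ k : ℕ, (M.pathMeasure σ).real (M.manySteps δ (k * δ) k) ≤
      1 - (1 + M.maxRate * δ) ^ k * Real.exp (-(M.maxRate * k * δ))) ∧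
    ∀ (G : Set S) (I : TimeInterval), I.WellFormed δ →
      (M.pathMeasure σ).real (M.timedReach I G) ∈
        Set.Icc
          ((M.pathMeasure σ).real (M.inducedPaths δ (M.dsReach hδ (I.digitize δ) G)) -
            I.lowerError M.maxRate δ)
          ((M.pathMeasure σ).real (M.inducedPaths δ (M.dsReach hδ (I.digitize δ) G)) +
            I.upperError M.maxRate δ) := by
  refine ⟨fun k => (measureReal_mono (M.manySteps_subset δ (by positivity) k)).trans
    (M.measure_stepCount_gt_le σ hδ k), fun G I hI => ?_⟩
  have herr : ∀ m : ℕ, 1 - (1 + M.maxRate * δ) ^ (m * δ / δ) * Real.exp (-M.maxRate * (m * δ)) =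
      1 - (1 + M.maxRate * δ) ^ m * Real.exp (-(M.maxRate * m * δ)) := fun m => by
    rw [mul_div_cancel_right₀ _ hδ.ne', Real.rpow_natCast]
    ring_nf
  have hlow : ∀ (I : TimeInterval) (j : ℕ), I.lower = j * δ → (M.pathMeasure σ).real
      {ω | j ≠ 0 ∧ ∃ n, M.durSum ω n ≤ j * δ ∧ j < M.stepCount δ ω n} ≤
      I.lowerError M.maxRate δ := fun I j hI => by
    by_cases hj : j = 0
    · simp [hj, TimeInterval.lowerError, hI]
    · simpa [hj, hδ.ne', ← herr, TimeInterval.lowerError, hI]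
        using M.measure_stepCount_gt_le σ hδ j
  have hup : ∀ j : ℕ, (M.pathMeasure σ).real
      {ω | j ≠ 0 ∧ ∃ n, M.stepCount δ ω n ≤ j ∧ M.stepCount δ ω (n + 1) = j + 1} ≤
      if (j : ℝ) * δ = 0 then 0 else 1 - Real.exp (-M.maxRate * δ) := fun j => by
    by_cases hj : j = 0
    · simp [hj]
    · simpa [hj, hδ.ne'] using M.measure_stepCount_eq_le σ hδ j
  have hpos : ∀ j n : ℕ, (j : ℝ) * δ ≤ n * δ ∧ ¬ (0 < (j : ℝ) * δ ∧ (n : ℝ) * δ = j * δ) ↔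
      j = 0 ∨ j < n := fun j n => by
    rw [mul_le_mul_iff_left₀ hδ, mul_left_inj' hδ.ne', mul_pos_iff_of_pos_right hδ, Nat.cast_le,
      Nat.cast_pos, Nat.cast_inj]
    omega
  cases I with
  | bounded a b =>
    obtain ⟨-, hab, ⟨j, hj⟩, k, hk⟩ := hI
    obtain rfl := (div_eq_iff hδ.ne').1 hj
    obtain rfl := (div_eq_iff hδ.ne').1 hk
    -- Strictness of a < b puts count j + 1 within the upper bound, as the comparison requires.
    have hjk : j + 1 ≤ k := by
      have := lt_of_mul_lt_mul_right hab hδ.le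
      exact_mod_cast this
    have hU : IsLowerSet (Set.Iic ((k : ℝ) * δ)) := isLowerSet_Iic _
    have hIs : ∀ x, x ∈ (TimeInterval.bounded (j * δ) (k * δ)).toSet ↔
        j * δ ≤ x ∧ x ∈ Set.Iic ((k : ℝ) * δ) := fun x => Iff.rfl
    have hJ : ∀ n, n ∈ (TimeInterval.bounded (j * δ) (k * δ)).digitize δ ↔
        (j = 0 ∨ j < n) ∧ (n : ℝ) * δ ∈ Set.Iic ((k : ℝ) * δ) := fun n => by
      rw [← hpos]
      exact and_right_comm
    constructor
    · have h1 := (measureReal_mono (μ := M.pathMeasure σ)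
        (M.inducedPaths_subset hδ hU hIs hJ G hab.le)).trans (measureReal_union_le _ _)
      have h2 := hlow (.bounded (j * δ) (k * δ)) j rfl
      linarith
    · have h0 : ((j + 1 : ℕ) : ℝ) * δ ∈ Set.Iic ((k : ℝ) * δ) :=
        mul_le_mul_of_nonneg_right (Nat.cast_le.2 hjk) hδ.le
      have h1 := (measureReal_mono (μ := M.pathMeasure σ)
        (M.timedReach_subset hδ hU hIs hJ G h0)).trans (measureReal_union_le _ _)
      have h2 := measureReal_union_le (μ := M.pathMeasure σ)
        {ω | ∃ n, M.durSum ω n ∈ Set.Iic ((k : ℝ) * δ) ∧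
          M.stepCount δ ω n * δ ∉ Set.Iic ((k : ℝ) * δ)}
        {ω | j ≠ 0 ∧ ∃ n, M.stepCount δ ω n ≤ j ∧ M.stepCount δ ω (n + 1) = j + 1}
      have h3 := M.measure_stepCount_gt_le σ hδ k
      have h4 : {ω | ∃ n, M.durSum ω n ∈ Set.Iic ((k : ℝ) * δ) ∧
          M.stepCount δ ω n * δ ∉ Set.Iic ((k : ℝ) * δ)} =
          {ω | ∃ n, M.durSum ω n ≤ k * δ ∧ k < M.stepCount δ ω n} := by
        simp only [Set.mem_Iic, not_le, mul_lt_mul_iff_left₀ hδ, Nat.cast_lt]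
      rw [h4] at h1 h2
      have h5 := hup j
      simp only [TimeInterval.upperError, herr]
      linarith
  | unbounded a =>
    obtain ⟨-, j, hj⟩ := hI
    obtain rfl := (div_eq_iff hδ.ne').1 hj
    have hU : IsLowerSet (Set.univ : Set ℝ) := isLowerSet_univ
    have hIs : ∀ x, x ∈ (TimeInterval.unbounded (j * δ)).toSet ↔
        j * δ ≤ x ∧ x ∈ (Set.univ : Set ℝ) := fun x => (and_iff_left trivial).symm
    have hJ : ∀ n, n ∈ (TimeInterval.unbounded (j * δ)).digitize δ ↔
        (j = 0 ∨ j < n) ∧ (n : ℝ) * δ ∈ (Set.univ : Set ℝ) := fun n => by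
      rw [← hpos]
      exact (and_iff_left trivial).symm
    constructor
    · have h1 := (measureReal_mono (μ := M.pathMeasure σ)
        (M.inducedPaths_subset hδ hU hIs hJ G trivial)).trans (measureReal_union_le _ _)
      have h2 := hlow (.unbounded (j * δ)) j rfl
      linarith
    · have h1 := (measureReal_mono (μ := M.pathMeasure σ)
        (M.timedReach_subset hδ hU hIs hJ G trivial)).trans (measureReal_union_le _ _)
      simp only [Set.mem_univ, not_true_eq_false, and_false, exists_false, Set.ofPred_false,
        Set.empty_union] at h1
      have h2 := hup j
      simp only [TimeInterval.upperError]
      linarith
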